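/- Let $\mathbb{M}$ be a monoid. A flow on an object $X$ of a concrete category $\mathcal{C}$ is a monoid morphism $\mathbb{M}\to\mathcal{C}(X,X)$, also regarded as a map $\triangleright:\mathbb{M}\times X\to X$; for a constraint $\mathcal{F}$ on flows, ${}_{\mathcal{F}}\mathcal{C}^{\mathbb{M}}$ is the category of flows in $\mathcal{C}$ satisfying $\mathcal{F}$, with equivariant morphisms. Let $\mathcal{S},\mathcal{J}\subseteq 2^{\mathbb{M}}$ be families of subsets. Consider the following classes of categories, with constraints $\mathcal{F}$. (a) $\mathbb{M}$ is a topological monoid; the categories are the full subcategories of $\mathrm{Top}$ on all, the $T_0$, $T_1$, $T_2$, functionally Hausdorff (distinct points are separated by continuous real-valued functions), Tychonoff, or compact Hausdorff spaces; $\mathcal{F}$ requires separate continuity of the action over $S\times X$ for $S\in\mathcal{S}$ and joint continuity over $J\times X$ for $J\in\mathcal{J}$. (b) $\mathbb{M}$ is a monoid equipped with a uniformity; the categories are the full subcategories of $\mathrm{Unif}$ on all, the Hausdorff, complete Hausdorff, or compact Hausdorff spaces (the latter with their unique compatible uniformity); $\mathcal{F}$ requires separate uniform continuity over $S\times X$ for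 $S\in\mathcal{S}$ and joint uniform continuity over $J\times X$ for $J\in\mathcal{J}$. (c) $\mathbb{M}$ is a monoid internal to the category $\mathrm{Top}_\kappa$ of compactly generated spaces (those whose open sets are precisely the sets with open intersection with every compact subspace), $\kappa:\mathrm{Top}\to\mathrm{Top}_\kappa$ is the coreflection and $X\times^\kappa Y:=\kappa(X\times Y)$; the categories are $\mathrm{Top}_\kappa$ and its full subcategory of Hausdorff spaces; $\mathcal{F}$ requires separate continuity over $\kappa(S)\times X$ for $S\in\mathcal{S}$ and joint continuity over $\kappa(J)\times^\kappa X$ for $J\in\mathcal{J}$. (d) $\mathbb{M}$ is a topological group and the categories are as in (b); $\mathcal{F}$ requires either that flows be bounded (for every entourage $V$ of $X$ there is a neighborhood $N$ of $1$ with $(s\triangleright x,x)\in V$ for all $s\in N$, $x\in X$), or that they be quasi-bounded (for every entourage $W$ of $X$ there are a neighborhood $N$ of $1$ and an entourage $V$ of $X$ with $(s\triangleright x,s\triangleright y)\in W$ for all $s\in N$, $(x,y)\in V$). Let $\mathcal{C}\hookrightarrow\mathcal{D}$ be an inclusion between two categories in the same item, and fix a constraint $\mathcal{F}$ from that item. Then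 ${}_{\mathcal{F}}\mathcal{C}^{\mathbb{M}}$ is reflective in ${}_{\mathcal{F}}\mathcal{D}^{\mathbb{M}}$, and ${}_{\mathcal{F}}\mathcal{D}^{\mathbb{M}}$ is cocomplete. Moreover, the full subcategory of ${}_{\mathcal{F}}\mathcal{D}^{\mathbb{M}}$ on those flows $X$ whose reflection $X\to Y$ in ${}_{\mathcal{F}}\mathcal{C}^{\mathbb{M}}$ is an isomorphism onto its image (a homeomorphism onto its image in (a) and (c), a uniform isomorphism onto its image in (b) and (d)) is reflective in ${}_{\mathcal{F}}\mathcal{D}^{\mathbb{M}}$ and is cocomplete. -/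

import Mathlib

open CategoryTheory CategoryTheory.Limits Topology Uniformity

universe u v w

namespace EquivariantFlows

/-! ### Flows in a category, subject to a constraint -/

section General

variable {B : Type w} [Category.{v} B] {M : Type u} [Monoid M]

/-- A flow of the monoid `M` on an object of `B` is a monoid morphism `M →* End X`, i.e. an object
of Mathlib's `Action B M`; morphisms of flows are the `M`-equivariant morphisms of `B`.
For a full subcategory of `B` (given by `P`) and a constraint `F` on flows, this singles out the
flows carried by objects of the subcategory and satisfying the constraint. -/
def flowProp (P : ObjectProperty B) (F : ObjectProperty (Action B M)) :
    ObjectProperty (Action B M) :=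
  fun X => P X.V ∧ F X

/-- The category of flows in the full subcategory `P` of `B` that satisfy the constraint `F`. -/
abbrev Flow (P : ObjectProperty B) (F : ObjectProperty (Action B M)) :=
  (flowProp P F).FullSubcategory

theorem flowProp_mono {P Q : ObjectProperty B} (h : P ≤ Q) (F : ObjectProperty (Action B M)) :
    flowProp P F ≤ flowProp Q F :=
  fun _ hX => ⟨h _ hX.1, hX.2⟩

/-- The inclusion of flow categories induced by an inclusion of full subcategories of `B`. -/
abbrev flowIncl {P Q : ObjectProperty B} (h : P ≤ Q) (F : ObjectProperty (Action B M)) :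
    Flow P F ⥤ Flow Q F :=
  ObjectProperty.ιOfLE (flowProp_mono h F)

/-- `r : X ⟶ R Y` is a reflection of `X` along `R`: it is universal among morphisms from `X` to
objects in the range of `R`. -/
def IsReflection {A : Type*} [Category A] {D : Type*} [Category D] (R : A ⥤ D) {X : D} {Y : A}
    (r : X ⟶ R.obj Y) : Prop :=
  ∀ (Z : A) (f : X ⟶ R.obj Z), ∃! g : Y ⟶ Z, r ≫ R.map g = f

/-- The flows `X` in `Q` whose reflection `X ⟶ Y` among the flows in `P` is an isomorphism onto its
image, where `E` expresses what it means for a morphism of `B` to be an isomorphism onto its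
image. -/
def embedsInReflection (E : MorphismProperty B) {P Q : ObjectProperty B} (h : P ≤ Q)
    (F : ObjectProperty (Action B M)) : ObjectProperty (Flow Q F) :=
  fun X => ∃ (Y : Flow P F) (r : X ⟶ (flowIncl h F).obj Y),
    IsReflection (flowIncl h F) r ∧ E r.hom.hom

end General

/-! ### Topological spaces -/

/-- Functionally Hausdorff spaces: distinct points are separated by continuous real functions. -/
def FunctionallyHausdorff (X : Type*) [TopologicalSpace X] : Prop :=
  ∀ x y : X, x ≠ y → ∃ f : X → ℝ, Continuous f ∧ f x ≠ f y

/-- Labels for the classes of topological spaces under consideration. -/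
inductive TopClass
  | all | T0 | T1 | T2 | T2f | Tychonoff | compactT2

/-- The full subcategory of `TopCat` named by a label. -/
def TopClass.prop : TopClass → ObjectProperty TopCat.{u}
  | all => fun _ => True
  | T0 => fun X => T0Space X
  | T1 => fun X => T1Space X
  | T2 => fun X => T2Space X
  | T2f => fun X => FunctionallyHausdorff X
  | Tychonoff => fun X => T35Space X
  | compactT2 => fun X => CompactSpace X ∧ T2Space X

/-- Topological embeddings, i.e. homeomorphisms onto the image. -/
def topEmbedding : MorphismProperty TopCat.{u} :=
  fun _ _ f => IsEmbedding f

/-- The map `x ↦ m ▷ x` of a flow on a topological space. -/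
def topAct {M : Type u} [Monoid M] (X : Action TopCat.{u} M) (m : M) (x : X.V) : X.V :=
  End.asHom (X.ρ m) x

/-- Flows on topological spaces that are separately continuous over `S × X` for all `S ∈ 𝒮`, and
jointly continuous over `J × X` for all `J ∈ 𝒥`. (Continuity in the variable `x ∈ X` alone is part
of being a flow.) -/
def topConstraint {M : Type u} [Monoid M] [TopologicalSpace M] (𝒮 𝒥 : Set (Set M)) :
    ObjectProperty (Action TopCat.{u} M) :=
  fun X => (∀ S ∈ 𝒮, ∀ x : X.V, Continuous fun s : S => topAct X s x) ∧
    ∀ J ∈ 𝒥, Continuous fun p : J × X.V => topAct X p.1 p.2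

/-! ### Compactly generated spaces

`CompactlyCoherentSpace X`: the open sets of `X` are precisely those having open intersection with
every compact subspace. `CompactCoherentification X`: the associated coreflection. -/

/-- Labels for the classes of compactly generated spaces under consideration. -/
inductive KTopClass
  | all | T2

/-- The full subcategory of `TopCat` named by a label. -/
def KTopClass.prop : KTopClass → ObjectProperty TopCat.{u}
  | all => fun X => CompactlyCoherentSpace X
  | T2 => fun X => CompactlyCoherentSpace X ∧ T2Space X

/-- The `κ`-product: the coreflection of the Cartesian product. -/
abbrev KProd (X Y : Type*) := CompactCoherentification (X × Y)

/-- A monoid internal to compactly generated spaces: the underlying space is compactly generated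
and multiplication is continuous on the `κ`-product. -/
structure IsKMonoid (M : Type*) [Monoid M] [TopologicalSpace M] : Prop where
  compactlyCoherent : CompactlyCoherentSpace M
  continuous_mul : Continuous fun p : KProd M M =>
    ((CompactCoherentification.mk (M × M)).symm p).1 *
      ((CompactCoherentification.mk (M × M)).symm p).2

/-- Flows that are separately continuous over `κ(S) × X` for all `S ∈ 𝒮`, and jointly continuous
over the `κ`-product of `κ(J)` and `X` for all `J ∈ 𝒥`. -/
def kTopConstraint {M : Type u} [Monoid M] [TopologicalSpace M] (𝒮 𝒥 : Set (Set M)) :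
    ObjectProperty (Action TopCat.{u} M) :=
  fun X =>
    (∀ S ∈ 𝒮, ∀ x : X.V, Continuous fun s : CompactCoherentification S =>
      topAct X ((CompactCoherentification.mk S).symm s : S) x) ∧
    ∀ J ∈ 𝒥, Continuous fun p : KProd (CompactCoherentification J) X.V =>
      topAct X
        ((CompactCoherentification.mk J).symm
          ((CompactCoherentification.mk (CompactCoherentification J × X.V)).symm p).1 : J)
        ((CompactCoherentification.mk (CompactCoherentification J × X.V)).symm p).2

/-! ### Uniform spaces -/

/-- Labels for the classes of uniform spaces under consideration. Compact Hausdorff spaces are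
regarded as uniform spaces by means of their unique compatible uniformity. -/
inductive UnifClass
  | all | T2 | completeT2 | compactT2

/-- The full subcategory of `UniformSpaceCat` named by a label. -/
def UnifClass.prop : UnifClass → ObjectProperty UniformSpaceCat.{u}
  | all => fun _ => True
  | T2 => fun X => T2Space X
  | completeT2 => fun X => CompleteSpace X ∧ T2Space X
  | compactT2 => fun X => CompactSpace X ∧ T2Space X

/-- Uniform embeddings, i.e. uniform isomorphisms onto the image. -/
def unifEmbedding : MorphismProperty UniformSpaceCat.{u} :=
  fun _ _ f => IsUniformEmbedding f

/-- The map `x ↦ m ▷ x` of a flow on a uniform space. -/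
def unifAct {M : Type u} [Monoid M] (X : Action UniformSpaceCat.{u} M) (m : M) (x : X.V) : X.V :=
  End.asHom (X.ρ m) x

/-- Flows on uniform spaces that are separately uniformly continuous over `S × X` for all `S ∈ 𝒮`,
and jointly uniformly continuous over `J × X` for all `J ∈ 𝒥`. (Uniform continuity in the variable
`x ∈ X` alone is part of being a flow.) -/
def unifConstraint {M : Type u} [Monoid M] [UniformSpace M] (𝒮 𝒥 : Set (Set M)) :
    ObjectProperty (Action UniformSpaceCat.{u} M) :=
  fun X => (∀ S ∈ 𝒮, ∀ x : X.V, UniformContinuous fun s : S => unifAct X s x) ∧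
    ∀ J ∈ 𝒥, UniformContinuous fun p : J × X.V => unifAct X p.1 p.2

/-- Bounded flows on uniform spaces. -/
def bounded {G : Type u} [Group G] [TopologicalSpace G] :
    ObjectProperty (Action UniformSpaceCat.{u} G) :=
  fun X => ∀ V ∈ 𝓤 X.V, ∃ N ∈ 𝓝 (1 : G), ∀ s ∈ N, ∀ x : X.V, (unifAct X s x, x) ∈ V

/-- Quasi-bounded flows on uniform spaces. -/
def quasiBounded {G : Type u} [Group G] [TopologicalSpace G] :
    ObjectProperty (Action UniformSpaceCat.{u} G) :=
  fun X => ∀ W ∈ 𝓤 X.V, ∃ N ∈ 𝓝 (1 : G), ∃ V ∈ 𝓤 X.V, ∀ s ∈ N, ∀ x y : X.V,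
    (x, y) ∈ V → (unifAct X s x, unifAct X s y) ∈ W

end EquivariantFlows

/-! The forgetful functor from flows on all spaces of a given kind (topological, compactly
generated, uniform) to sets with an `M`-action admits initial lifts of arbitrary families, even
large ones: the infimum of the pulled-back structures lives in a small complete lattice, so no
solution-set argument is needed. What has to be checked is that the constraint survives: each
constraint says that certain maps into the flow are (uniformly) continuous or that a filter tends to
the uniformity, and this is tested on the maps of the family. Colimits therefore lift from `M`-sets
(`hasColimitsOfShape_of_initialLift`).

For a class closed under initial structures of point-separating families, the reflection of `X` is
the quotient by the points which no morphism into the class separates, with the initial structure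
for these morphisms (`hasReflections_of_separatesPoints`). Compactness and completeness require new
points. There the carrier is the set of ultrafilters on `X` whose images under all morphisms into
the class converge, modulo having the same limits (`exists_ultrafilter_quotient`). It is an `M`-set,
`X` has dense image in it, and compactness or completeness is read off from the ultrafilters.

For the flows that embed in their reflection, the reflection `X ⟶ Y` is factored as a surjection
onto its image followed by an embedding. Surjections being epi, the embedding is again a reflection,
so the image has the required property; surjections being orthogonal to embeddings, the image is
universal (`hasReflections_of_factorization`). Where images may leave the ambient class (compactly
generated or complete Hausdorff spaces), a flow that embeds in its reflection already lies in the
smaller class, and the old reflection serves (`hasReflections_embedsInReflection_of_eq`).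
Cocompleteness passes to reflective subcategories throughout. -/

namespace EquivariantFlows

/-! ### Initial lifts, colimits and reflections in abstract categories -/

section Abstract

variable {A : Type*} [Category* A] {D : Type*} [Category* D]

/-- Every object has a reflection among the objects satisfying `P`. -/
def HasReflections (P : ObjectProperty A) : Prop :=
  ∀ X : A, ∃ Y : A, P Y ∧ ∃ r : X ⟶ Y, ∀ Z : A, P Z → ∀ f : X ⟶ Z, ∃! g : Y ⟶ Z, r ≫ g = f

theorem nonempty_reflective_of_isReflection (R : A ⥤ D) [R.Full] [R.Faithful]
    (h : ∀ X : D, ∃ (Y : A) (r : X ⟶ R.obj Y), IsReflection R r) : Nonempty (Reflective R) := by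
  have : ∀ X : D, HasInitial (StructuredArrow X R) := by
    intro X
    obtain ⟨Y, r, hr⟩ := h X
    refine IsInitial.hasInitial (X := StructuredArrow.mk r) ?_
    refine IsInitial.ofUniqueHom (fun W => StructuredArrow.homMk (hr W.right W.hom).choose
      (hr W.right W.hom).choose_spec.1) fun W m => ?_
    refine StructuredArrow.ext _ _ ?_
    exact (hr W.right W.hom).choose_spec.2 m.right (StructuredArrow.w m)
  exact ⟨{ L := leftAdjointOfStructuredArrowInitials R
           adj := adjunctionOfStructuredArrowInitials R }⟩

theorem HasReflections.nonempty_reflective {P : ObjectProperty A} (h : HasReflections P) :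
    Nonempty (Reflective P.ι) := by
  refine nonempty_reflective_of_isReflection _ fun X => ?_
  obtain ⟨Y, hY, r, hr⟩ := h X
  refine ⟨⟨Y, hY⟩, r, fun Z f => ?_⟩
  obtain ⟨g, hg, huniq⟩ := hr Z.obj Z.property f
  refine ⟨ObjectProperty.homMk g, hg, fun g' hg' => ?_⟩
  ext
  exact huniq _ hg'

/-- An initial lift of a (possibly large) family `Φ` of morphisms from `S` to objects in the image
of `U`. -/
structure InitialLift (U : A ⥤ D) {S : D} (Φ : ∀ Z : A, (S ⟶ U.obj Z) → Prop) where
  /-- The object lifting `S`. -/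
  obj : A
  /-- The object lies over `S`. -/
  iso : U.obj obj ≅ S
  lift : ∀ Z g, Φ Z g → ∃ l : obj ⟶ Z, U.map l = iso.hom ≫ g
  factor : ∀ (W : A) (k : U.obj W ⟶ S),
    (∀ Z g, Φ Z g → ∃ l : W ⟶ Z, U.map l = k ≫ g) → ∃ l : W ⟶ obj, U.map l ≫ iso.hom = k

/-- Initial lifts yield final ones: the colimit in `D` receives the structure initial for all maps
out of it whose composites with every leg lift to `A`. The legs lift by the factorization property,
and the map induced by any cocone belongs to the family. -/
theorem hasColimitsOfShape_of_initialLift (U : A ⥤ D) [U.Faithful]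
    (init : ∀ (S : D) (Φ : ∀ Z : A, (S ⟶ U.obj Z) → Prop), Nonempty (InitialLift U Φ))
    (J : Type*) [Category* J] [HasColimitsOfShape J D] : HasColimitsOfShape J A := by
  refine ⟨fun K => ?_⟩
  let c := colimit.cocone (K ⋙ U)
  have hc : IsColimit c := colimit.isColimit (K ⋙ U)
  let Φ : ∀ Z : A, (c.pt ⟶ U.obj Z) → Prop :=
    fun Z g => ∀ j, ∃ l : K.obj j ⟶ Z, U.map l = c.ι.app j ≫ g
  obtain ⟨L⟩ := init c.pt Φ
  choose ι hι using fun j => L.factor (K.obj j) (c.ι.app j) fun Z g h => h j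
  have hι' : ∀ j, U.map (ι j) = c.ι.app j ≫ L.iso.inv := fun j => by rw [← hι j]; simp
  let C : Cocone K :=
    { pt := L.obj
      ι := { app := ι
             naturality := fun i j f => U.map_injective (by
              have := c.w f
              simp only [Functor.comp_map] at this
              simp [hι', reassoc_of% this]) } }
  have key : ∀ s : Cocone K, ∃ l : L.obj ⟶ s.pt, U.map l = L.iso.hom ≫ hc.desc (U.mapCocone s) :=
    fun s => L.lift _ _ fun j => ⟨s.ι.app j, by rw [hc.fac]; rfl⟩
  choose desc hdesc using key
  refine ⟨⟨C, ⟨desc, fun s j => U.map_injective ?_, fun s m hm => U.map_injective ?_⟩⟩⟩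
  · simp only [Functor.map_comp, hdesc]
    change U.map (ι j) ≫ _ = _
    rw [hι', Category.assoc, Iso.inv_hom_id_assoc, hc.fac]
    rfl
  · rw [hdesc, ← Iso.inv_comp_eq]
    refine hc.hom_ext fun j => ?_
    rw [hc.fac, ← Category.assoc, ← hι', ← U.map_comp]
    exact congrArg U.map (hm j)

/-- Common frame of the two reflection constructions: on a candidate carrier `Q` the structure is
initial for maps whose composite with `q` lifts. Then `q` lifts, morphisms into `P` extend along it,
and `hepi` gives uniqueness (from surjectivity or density of `q`). -/
theorem exists_reflection_of_initialLift (U : A ⥤ D) [U.Faithful] (P : ObjectProperty A) (X : A)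
    {Q : D} (q : U.obj X ⟶ Q) {Φ : ∀ Z : A, (Q ⟶ U.obj Z) → Prop} (L : InitialLift U Φ)
    (hΦ : ∀ Z g, Φ Z g → ∃ l : X ⟶ Z, U.map l = q ≫ g)
    (hfac : ∀ Z, P Z → ∀ f : X ⟶ Z, ∃ g, Φ Z g ∧ q ≫ g = U.map f)
    (hP : P L.obj)
    (hepi : ∀ Z, P Z → ∀ a b : L.obj ⟶ Z,
      q ≫ L.iso.inv ≫ U.map a = q ≫ L.iso.inv ≫ U.map b → a = b) :
    ∃ Y : A, P Y ∧ ∃ r : X ⟶ Y, ∀ Z : A, P Z → ∀ f : X ⟶ Z, ∃! g : Y ⟶ Z, r ≫ g = f := by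
  obtain ⟨r, hr⟩ := L.factor X q hΦ
  have hr' : U.map r = q ≫ L.iso.inv := by rw [← hr]; simp
  refine ⟨L.obj, hP, r, fun Z hZ f => ?_⟩
  obtain ⟨g, hg, hqg⟩ := hfac Z hZ f
  obtain ⟨l, hl⟩ := L.lift Z g hg
  refine ⟨l, U.map_injective (by simp [hr', hl, hqg]), fun l' hl' => hepi Z hZ _ _ ?_⟩
  rw [hl, Iso.inv_hom_id_assoc, hqg, ← hl', U.map_comp, hr', Category.assoc]

/-- The objects whose reflection is an `E`-morphism are reflective, provided the reflection
morphisms factor as a morphism left orthogonal to `E` followed by an `E`-morphism. -/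
theorem hasReflections_of_factorization (R : A ⥤ D) [R.Full] [R.Faithful]
    (E : MorphismProperty D) (K : ObjectProperty D)
    (hK : ∀ X, K X ↔ ∃ (Y : A) (r : X ⟶ R.obj Y), IsReflection R r ∧ E r)
    (hR : ∀ X : D, ∃ (Y : A) (r : X ⟶ R.obj Y), IsReflection R r)
    (hE : ∀ (X : D) (Y : A) (r : X ⟶ R.obj Y), ∃ (I : D) (p : X ⟶ I) (j : I ⟶ R.obj Y),
      p ≫ j = r ∧ E j ∧ Epi p ∧ ∀ (W : D) (V : A) (e : W ⟶ R.obj V) (f : X ⟶ W)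
        (g : I ⟶ R.obj V), E e → p ≫ g = f ≫ e → ∃ d : I ⟶ W, p ≫ d = f) :
    HasReflections K := by
  intro X
  obtain ⟨Y, r, hr⟩ := hR X
  obtain ⟨I, p, j, hpj, hj, hp, hlift⟩ := hE X Y r
  -- The second factor `j` is itself a reflection of `I`: maps out of `I` into the subcategory
  -- extend along `r = p ≫ j`, and `p` can be cancelled.
  refine ⟨I, (hK I).2 ⟨Y, j, ?_, hj⟩, p, ?_⟩
  · intro Z f
    obtain ⟨g, hg, huniq⟩ := hr Z (p ≫ f)
    refine ⟨g, ?_, fun g' hg' => huniq g' ?_⟩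
    · dsimp only at hg ⊢
      rw [← cancel_epi p, ← hg, ← hpj, Category.assoc]
    · dsimp only at hg' ⊢
      rw [← hg', ← hpj, Category.assoc]
  · intro W hW f
    obtain ⟨V, e, -, he⟩ := (hK W).1 hW
    -- Extending `f ≫ e` along `r` closes a square with `p` on one side and the `E`-morphism `e` on
    -- the other; its diagonal is the required factorization.
    obtain ⟨g, hg, -⟩ := hr V (f ≫ e)
    obtain ⟨d, hd⟩ := hlift W V e f (j ≫ R.map g) he (by
      rw [← hg, ← hpj, Category.assoc])
    refine ⟨d, hd, fun d' hd' => ?_⟩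
    dsimp only at hd'
    rw [← cancel_epi p, hd', hd]

end Abstract

/-! ### Transfer of reflections between flow categories -/

section FlowReflections

variable {B : Type w} [Category.{v} B] {M : Type u} [Monoid M]

/-- The flows in `P₀` whose underlying object lies in `P`. -/
def carrierProp {P₀ : ObjectProperty B} (P : ObjectProperty B) (F : ObjectProperty (Action B M)) :
    ObjectProperty (Flow P₀ F) :=
  fun X => P X.obj.V

/-- A reflection into `P` constructed in the largest category `P₀` remains universal in every
intermediate full subcategory, so only inclusions into `P₀` need a construction. -/
theorem exists_isReflection_flowIncl {P₀ P Q : ObjectProperty B} (h : P ≤ Q) (hQ : Q ≤ P₀)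
    (F : ObjectProperty (Action B M)) (hP : HasReflections (carrierProp (P₀ := P₀) P F))
    (X : Flow Q F) :
    ∃ (Y : Flow P F) (r : X ⟶ (flowIncl h F).obj Y), IsReflection (flowIncl h F) r := by
  obtain ⟨Y, hY, r, hr⟩ := hP ((flowIncl hQ F).obj X)
  refine ⟨⟨Y.obj, hY, Y.property.2⟩, ObjectProperty.homMk r.hom, fun Z f => ?_⟩
  obtain ⟨g, hg, huniq⟩ := hr ((flowIncl (h.trans hQ) F).obj Z) Z.property.1
    (ObjectProperty.homMk f.hom)
  refine ⟨ObjectProperty.homMk g.hom, ?_, fun g' hg' => ?_⟩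
  · ext : 1
    exact congrArg (fun k => k.hom) hg
  · ext : 1
    refine congrArg (fun k => k.hom) (huniq (ObjectProperty.homMk g'.hom) ?_)
    ext : 1
    exact congrArg (fun k => k.hom) hg'

theorem hasColimits_of_hasReflections {A : Type*} [Category.{v} A] {P : ObjectProperty A}
    (h : HasReflections P) [HasColimitsOfSize.{v, v} A] :
    HasColimitsOfSize.{v, v} P.FullSubcategory := by
  obtain ⟨_⟩ := h.nonempty_reflective
  exact hasColimits_of_reflective P.ι

/-- By `hE`, flows that embed in their reflection already lie in `P`; conversely flows in `P` are
their own reflections. The reflection into `P` thus also reflects onto this subcategory, and no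
image factorization is needed. -/
theorem hasReflections_embedsInReflection_of_eq {P Q : ObjectProperty B} (h : P ≤ Q)
    (F : ObjectProperty (Action B M)) (E : MorphismProperty B) (hid : ∀ X : B, E (𝟙 X))
    (hR : ∀ X : Flow Q F,
      ∃ (Y : Flow P F) (r : X ⟶ (flowIncl h F).obj Y), IsReflection (flowIncl h F) r)
    (hE : ∀ (X Y : B) (f : X ⟶ Y), Q X → P Y → E f → P X) :
    HasReflections (embedsInReflection E h F) := by
  intro X
  obtain ⟨Y, r, hr⟩ := hR X
  refine ⟨(flowIncl h F).obj Y, ⟨Y, 𝟙 _, fun Z f => ⟨ObjectProperty.homMk f.hom, ?_, ?_⟩,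
    hid _⟩, r, fun Z hZ f => ?_⟩
  · exact Category.id_comp _
  · intro g hg
    rw [← (Category.id_comp _).symm.trans hg]
    rfl
  · obtain ⟨V, e, -, he⟩ := hZ
    obtain ⟨g, hg, huniq⟩ := hr ⟨Z.obj, hE _ _ _ Z.property.1 V.property.1 he, Z.property.2⟩ f
    refine ⟨(flowIncl h F).map g, hg, fun g' hg' => ?_⟩
    rw [← huniq (ObjectProperty.homMk g'.hom) hg']
    rfl

theorem reflective_and_cocomplete {P₀ P Q : ObjectProperty B} (h : P ≤ Q) (hQ : Q ≤ P₀)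
    (F : ObjectProperty (Action B M)) (E : MorphismProperty B)
    [HasColimitsOfSize.{v, v} (Flow P₀ F)]
    (hPr : HasReflections (carrierProp (P₀ := P₀) P F))
    (hQr : HasReflections (carrierProp (P₀ := P₀) Q F))
    (hEr : (∀ X : Flow Q F,
        ∃ (Y : Flow P F) (r : X ⟶ (flowIncl h F).obj Y), IsReflection (flowIncl h F) r) →
      HasReflections (embedsInReflection E h F)) :
    Nonempty (Reflective (flowIncl h F)) ∧ HasColimitsOfSize.{v, v} (Flow Q F) ∧
      Nonempty (Reflective (embedsInReflection E h F).ι) ∧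
      HasColimitsOfSize.{v, v} (embedsInReflection E h F).FullSubcategory := by
  have hP := exists_isReflection_flowIncl h hQ F hPr
  obtain ⟨_⟩ := nonempty_reflective_of_isReflection (flowIncl hQ F)
    (exists_isReflection_flowIncl hQ le_rfl F hQr)
  have hcol : HasColimitsOfSize.{v, v} (Flow Q F) := hasColimits_of_reflective (flowIncl hQ F)
  exact ⟨nonempty_reflective_of_isReflection _ hP, hcol, (hEr hP).nonempty_reflective,
    hasColimits_of_hasReflections (hEr hP)⟩

end FlowReflections

/-! ### Sets with an action and separated quotients -/

section Separated

variable {M : Type u} [Monoid M]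

/-- The map `x ↦ m ▷ x` of a flow on a set. -/
def typeAct (S : Action (Type u) M) (m : M) : S.V → S.V :=
  fun x => End.asHom (S.ρ m) x

theorem typeAct_one (S : Action (Type u) M) (x : S.V) : typeAct S 1 x = x := by
  simp [typeAct, End.asHom]

theorem typeAct_mul (S : Action (Type u) M) (m n : M) (x : S.V) :
    typeAct S (m * n) x = typeAct S m (typeAct S n x) := by
  simp [typeAct, End.asHom, End.mul_def]

theorem hom_typeAct {S T : Action (Type u) M} (f : S ⟶ T) (m : M) (x : S.V) :
    f.hom (typeAct S m x) = typeAct T m (f.hom x) :=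
  ConcreteCategory.congr_hom (f.comm m) x

/-- The flow on a set given by a family of self-maps. -/
def actionOfMaps (X : Type u) (a : M → X → X) (h1 : ∀ x, a 1 x = x)
    (hmul : ∀ m n x, a (m * n) x = a m (a n x)) : Action (Type u) M where
  V := X
  ρ :=
    { toFun m := End.of (TypeCat.ofHom (a m))
      map_one' := by
        change TypeCat.ofHom (a 1) = 𝟙 X
        ext x
        exact h1 x
      map_mul' m n := by
        change TypeCat.ofHom (a (m * n)) = TypeCat.ofHom (a n) ≫ TypeCat.ofHom (a m)
        ext x
        exact hmul m n x }

/-- An equivariant map, as a morphism. -/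
def homOfMap {S T : Action (Type u) M} (f : S.V → T.V)
    (hf : ∀ m x, f (typeAct S m x) = typeAct T m (f x)) : S ⟶ T where
  hom := TypeCat.ofHom f
  comm m := by ext x; exact hf m x

theorem typeHom_ext {S T : Action (Type u) M} {f g : S ⟶ T} (h : ∀ x, f.hom x = g.hom x) :
    f = g := by
  ext x
  exact h x

variable {A : Type*} [Category* A] (U : A ⥤ Action (Type u) M)

/-- Equivariance of the members of `Ψ` makes the relation of being identified by all of them a
congruence for the action. -/
theorem exists_separated_quotient {S : Action (Type u) M}
    (Ψ : ∀ Z : A, (S ⟶ U.obj Z) → Prop) :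
    ∃ (Q : Action (Type u) M) (q : S ⟶ Q), Function.Surjective q.hom ∧
      (∀ Z f, Ψ Z f → ∃ g, q ≫ g = f) ∧
      ∀ x y : S.V, (∀ Z f, Ψ Z f → f.hom x = f.hom y) → q.hom x = q.hom y := by
  let s : Setoid S.V :=
    { r x y := ∀ Z f, Ψ Z f → f.hom x = f.hom y
      iseqv := ⟨fun _ _ _ _ => rfl, fun h Z f hf => (h Z f hf).symm,
        fun h h' Z f hf => (h Z f hf).trans (h' Z f hf)⟩ }
  let Q : Action (Type u) M := actionOfMaps (Quotient s)
    (fun m => Quotient.map (typeAct S m) fun x y h Z f hf => by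
      rw [hom_typeAct, hom_typeAct, h Z f hf])
    (by rintro ⟨x⟩; exact congrArg (Quotient.mk s) (typeAct_one S x))
    (by rintro m n ⟨x⟩; exact congrArg (Quotient.mk s) (typeAct_mul S m n x))
  refine ⟨Q, homOfMap (Quotient.mk s) fun m x => rfl, Quotient.mk_surjective, fun Z f hf => ?_,
    fun x y h => Quotient.sound h⟩
  refine ⟨homOfMap (S := Q) (Quotient.lift (fun x => f.hom x) fun x y h => h Z f hf) ?_, ?_⟩
  · rintro m ⟨x⟩
    exact hom_typeAct f m x
  · exact typeHom_ext fun x => rfl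

/-- The family `Φ` separates the points of `S`. -/
def SeparatesPoints {S : Action (Type u) M} (Φ : ∀ Z : A, (S ⟶ U.obj Z) → Prop) : Prop :=
  ∀ x y : S.V, (∀ Z g, Φ Z g → g.hom x = g.hom y) → x = y

theorem hasReflections_of_separatesPoints [U.Faithful] (P : ObjectProperty A)
    (init : ∀ (S : Action (Type u) M) (Φ : ∀ Z : A, (S ⟶ U.obj Z) → Prop), InitialLift U Φ)
    (hP : ∀ (S : Action (Type u) M) (Φ : ∀ Z : A, (S ⟶ U.obj Z) → Prop),
      (∀ Z g, Φ Z g → P Z) → SeparatesPoints U Φ → P (init S Φ).obj) :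
    HasReflections P := by
  intro X
  obtain ⟨Q, q, hq, hfac, hsep⟩ := exists_separated_quotient U (S := U.obj X)
    fun Z f => P Z ∧ ∃ l : X ⟶ Z, U.map l = f
  let Φ : ∀ Z : A, (Q ⟶ U.obj Z) → Prop := fun Z g => P Z ∧ ∃ l : X ⟶ Z, U.map l = q ≫ g
  refine exists_reflection_of_initialLift U P X q (init Q Φ) (fun Z g h => h.2)
    (fun Z hZ f => ?_) (hP Q Φ (fun Z g h => h.1) ?_) fun Z hZ a b hab => U.map_injective ?_
  · obtain ⟨g, hg⟩ := hfac Z (U.map f) ⟨hZ, f, rfl⟩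
    exact ⟨g, ⟨hZ, f, hg.symm⟩, hg⟩
  · intro x y h
    obtain ⟨x, rfl⟩ := hq x
    obtain ⟨y, rfl⟩ := hq y
    refine hsep x y fun Z f hf => ?_
    obtain ⟨g, rfl⟩ := hfac Z f hf
    exact h Z g hf
  · rw [← cancel_epi (init Q Φ).iso.inv]
    refine typeHom_ext fun x => ?_
    obtain ⟨x, rfl⟩ := hq x
    exact ConcreteCategory.congr_hom (congrArg Action.Hom.hom hab) x

end Separated

/-! ### Reflections from convergent ultrafilters -/

section Ultrafilters

open Filter

variable {M : Type u} [Monoid M] {A : Type*} [Category* A] (U : A ⥤ Action (Type u) M)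

/-- The ultrafilters on a flow whose images under all morphisms to objects in `P` converge. -/
def convergentUltrafilters [∀ Z, TopologicalSpace (U.obj Z).V] (P : ObjectProperty A) (X : A) :
    Set (Ultrafilter (U.obj X).V) :=
  {u | ∀ Z, P Z → ∀ f : X ⟶ Z, ∃ z, Tendsto (U.map f).hom u (𝓝 z)}

/-- A separated quotient of the flow of convergent ultrafilters: the closure of the image of `X`
in the product of all its images in `P`. -/
theorem exists_ultrafilter_quotient [∀ Z, TopologicalSpace (U.obj Z).V]
    (hact : ∀ Z m, Continuous (typeAct (U.obj Z) m))
    (P : ObjectProperty A) (hT2 : ∀ Z, P Z → T2Space (U.obj Z).V) (X : A) :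
    ∃ (Q : Action (Type u) M) (q : U.obj X ⟶ Q) (Φ : ∀ Z : A, (Q ⟶ U.obj Z) → Prop),
      (∀ Z g, Φ Z g → P Z) ∧ SeparatesPoints U Φ ∧
      (∀ Z g, Φ Z g → ∃ l : X ⟶ Z, U.map l = q ≫ g) ∧
      (∀ Z, P Z → ∀ f : X ⟶ Z, ∃ g, Φ Z g ∧ q ≫ g = U.map f) ∧
      (∀ u ∈ convergentUltrafilters U P X, ∃ s : Q.V, ∀ Z g, Φ Z g →
        Tendsto (q ≫ g).hom u (𝓝 (g.hom s))) ∧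
      ∀ s : Q.V, ∃ u ∈ convergentUltrafilters U P X, ∀ Z g, Φ Z g →
        Tendsto (q ≫ g).hom u (𝓝 (g.hom s)) := by
  have hmap : ∀ (m : M), ∀ u ∈ convergentUltrafilters U P X,
      u.map (typeAct (U.obj X) m) ∈ convergentUltrafilters U P X := by
    intro m u hu Z hZ f
    obtain ⟨z, hz⟩ := hu Z hZ f
    refine ⟨typeAct _ m z, ?_⟩
    rw [Ultrafilter.coe_map, tendsto_map'_iff]
    have := ((hact Z m).tendsto z).comp hz
    refine this.congr fun x => ?_
    exact (hom_typeAct (U.map f) m x).symm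
  let S : Action (Type u) M := actionOfMaps (convergentUltrafilters U P X)
    (fun m u => ⟨u.1.map (typeAct (U.obj X) m), hmap m u.1 u.2⟩)
    (fun u => by
      refine Subtype.ext ?_
      change Ultrafilter.map _ _ = _
      rw [show typeAct (U.obj X) 1 = id from funext (typeAct_one _), Ultrafilter.map_id])
    (fun m n u => by
      refine Subtype.ext ?_
      change Ultrafilter.map _ _ = Ultrafilter.map _ (Ultrafilter.map _ _)
      rw [Ultrafilter.map_map]
      congr 1
      exact funext (typeAct_mul _ m n))
  have hpure : ∀ x : (U.obj X).V, (pure x : Ultrafilter _) ∈ convergentUltrafilters U P X := by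
    intro x Z hZ f
    exact ⟨_, tendsto_pure_nhds _ _⟩
  let i : U.obj X ⟶ S := homOfMap (fun x => ⟨pure x, hpure x⟩) fun m x =>
    Subtype.ext (Ultrafilter.map_pure _ _).symm
  -- These are the extensions of morphisms `l` out of `X` by limits along ultrafilters; principal
  -- ultrafilters show that such an extension restricts to `l`.
  let Ψ : ∀ Z : A, (S ⟶ U.obj Z) → Prop := fun Z g =>
    P Z ∧ ∃ l : X ⟶ Z, ∀ u : convergentUltrafilters U P X, Tendsto (U.map l).hom u.1 (𝓝 (g.hom u))
  have hΨi : ∀ Z g (hZ : P Z) (l : X ⟶ Z),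
      (∀ u : convergentUltrafilters U P X, Tendsto (U.map l).hom u.1 (𝓝 (g.hom u))) →
      U.map l = i ≫ g := by
    intro Z g hZ l hl
    refine typeHom_ext fun x => ?_
    have := hT2 Z hZ
    exact tendsto_nhds_unique (tendsto_pure_nhds _ _) (hl ⟨pure x, hpure x⟩)
  obtain ⟨Q, q, hq, hfac, hsep⟩ := exists_separated_quotient U Ψ
  have hconv : ∀ (u : convergentUltrafilters U P X) Z g, Ψ Z (q ≫ g) →
      Tendsto ((i ≫ q) ≫ g).hom u.1 (𝓝 (g.hom (q.hom u))) := by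
    rintro u Z g ⟨hZ, l, hl⟩
    rw [Category.assoc, ← hΨi Z _ hZ l hl]
    exact hl u
  refine ⟨Q, i ≫ q, fun Z g => Ψ Z (q ≫ g), fun Z g h => h.1, ?_, ?_, ?_,
    fun u hu => ⟨q.hom (⟨u, hu⟩ : convergentUltrafilters U P X), fun Z g hg =>
      hconv ⟨u, hu⟩ Z g hg⟩, fun s => ?_⟩
  · intro x y h
    obtain ⟨x, rfl⟩ := hq x
    obtain ⟨y, rfl⟩ := hq y
    refine hsep x y fun Z f hf => ?_
    obtain ⟨g, rfl⟩ := hfac Z f hf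
    exact h Z g hf
  · rintro Z g ⟨hZ, l, hl⟩
    exact ⟨l, by rw [Category.assoc]; exact hΨi Z _ hZ l hl⟩
  · intro Z hZ f
    have := hT2 Z hZ
    choose φ hφ using fun u : convergentUltrafilters U P X => u.2 Z hZ f
    -- Limits in a Hausdorff space are unique and the action is continuous, so taking limits is
    -- equivariant.
    let g : S ⟶ U.obj Z := homOfMap φ fun m u => by
      refine tendsto_nhds_unique (hφ _) ?_
      change Tendsto _ (Filter.map _ _) _
      rw [tendsto_map'_iff]
      refine (((hact Z m).tendsto _).comp (hφ u)).congr fun x => ?_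
      exact (hom_typeAct (U.map f) m x).symm
    have hg : Ψ Z g := ⟨hZ, f, hφ⟩
    obtain ⟨g', hg'⟩ := hfac Z g hg
    exact ⟨g', by dsimp only; rwa [hg'], by rw [Category.assoc, hg', ← hΨi Z g hZ f hφ]⟩
  · obtain ⟨u, rfl⟩ := hq s
    exact ⟨u.1, u.2, fun Z g hg => hconv u Z g hg⟩

/-- Reflectivity of a class of Hausdorff objects from the ultrafilter construction. -/
theorem hasReflections_of_ultrafilter [U.Faithful] [∀ Z, TopologicalSpace (U.obj Z).V]
    (hact : ∀ Z m, Continuous (typeAct (U.obj Z) m))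
    (hmor : ∀ {Z W : A} (f : Z ⟶ W), Continuous (U.map f).hom)
    (init : ∀ (S : Action (Type u) M) (Φ : ∀ Z : A, (S ⟶ U.obj Z) → Prop), InitialLift U Φ)
    (hinit : ∀ (S : Action (Type u) M) (Φ : ∀ Z : A, (S ⟶ U.obj Z) → Prop) {ι : Type u}
      (l : Filter ι) (k : ι → S.V) (s : S.V),
      (∀ Z g, Φ Z g → Tendsto (fun i => g.hom (k i)) l (𝓝 (g.hom s))) →
      Tendsto (fun i => (init S Φ).iso.inv.hom (k i)) l (𝓝 ((init S Φ).iso.inv.hom s)))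
    (P : ObjectProperty A) (hT2 : ∀ Z, P Z → T2Space (U.obj Z).V)
    (hP : ∀ (X : A) (Q : Action (Type u) M) (q : U.obj X ⟶ Q)
      (Φ : ∀ Z : A, (Q ⟶ U.obj Z) → Prop), (∀ Z g, Φ Z g → P Z) → SeparatesPoints U Φ →
      (∀ Z g, Φ Z g → ∃ l : X ⟶ Z, U.map l = q ≫ g) →
      (∀ Z, P Z → ∀ f : X ⟶ Z, ∃ g, Φ Z g ∧ q ≫ g = U.map f) →
      (∀ u ∈ convergentUltrafilters U P X, ∃ s : Q.V, ∀ Z g, Φ Z g →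
        Tendsto (q ≫ g).hom u (𝓝 (g.hom s))) →
      (∀ s : Q.V, ∃ u ∈ convergentUltrafilters U P X, ∀ Z g, Φ Z g →
        Tendsto (q ≫ g).hom u (𝓝 (g.hom s))) →
      DenseRange (fun x => (init Q Φ).iso.inv.hom (q.hom x)) → P (init Q Φ).obj) :
    HasReflections P := by
  intro X
  obtain ⟨Q, q, Φ, h1, h2, h3, h4, h5, h6⟩ := exists_ultrafilter_quotient U hact P hT2 X
  have hdense : DenseRange (fun x => (init Q Φ).iso.inv.hom (q.hom x)) := by
    intro y
    obtain ⟨u, -, hu⟩ := h6 ((init Q Φ).iso.hom.hom y)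
    have := hinit Q Φ (u : Filter (U.obj X).V) (fun x => q.hom x) _ fun Z g hg => hu Z g hg
    have hy : (init Q Φ).iso.inv.hom ((init Q Φ).iso.hom.hom y) = y :=
      ConcreteCategory.congr_hom (congrArg Action.Hom.hom (init Q Φ).iso.hom_inv_id) y
    rw [hy] at this
    exact mem_closure_of_tendsto this (Eventually.of_forall fun x => ⟨x, rfl⟩)
  refine exists_reflection_of_initialLift U P X q (init Q Φ) h3 h4
    (hP X Q q Φ h1 h2 h3 h4 h5 h6 hdense) fun Z hZ a b hab => U.map_injective ?_
  have := hT2 Z hZ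
  refine typeHom_ext fun y => congrFun (hdense.equalizer (hmor a) (hmor b) ?_) y
  funext x
  exact ConcreteCategory.congr_hom (congrArg Action.Hom.hom hab) x

theorem t2Space_initialLift [∀ Z, TopologicalSpace (U.obj Z).V]
    (hmor : ∀ {Z W : A} (f : Z ⟶ W), Continuous (U.map f).hom)
    {S : Action (Type u) M} {Φ : ∀ Z : A, (S ⟶ U.obj Z) → Prop} (L : InitialLift U Φ)
    (hΦ : ∀ Z g, Φ Z g → T2Space (U.obj Z).V) (hsep : SeparatesPoints U Φ) :
    T2Space (U.obj L.obj).V := by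
  refine ⟨fun x y hxy => ?_⟩
  have hinv : ∀ y, L.iso.inv.hom (L.iso.hom.hom y) = y := fun y =>
    ConcreteCategory.congr_hom (congrArg Action.Hom.hom L.iso.hom_inv_id) y
  have : ∃ Z g, Φ Z g ∧ g.hom (L.iso.hom.hom x) ≠ g.hom (L.iso.hom.hom y) := by
    by_contra! hcon
    apply hxy
    rw [← hinv x, ← hinv y, hsep _ _ hcon]
  obtain ⟨Z, g, hg, hne⟩ := this
  obtain ⟨l, hl⟩ := L.lift Z g hg
  have := hΦ Z g hg
  have hl' : ∀ z, (U.map l).hom z = g.hom (L.iso.hom.hom z) := fun z =>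
    ConcreteCategory.congr_hom (congrArg Action.Hom.hom hl) z
  exact separated_by_continuous (hmor l) (by rwa [hl', hl'])

/-- Compact Hausdorff objects are reflective. -/
theorem hasReflections_compactT2 [U.Faithful] [∀ Z, TopologicalSpace (U.obj Z).V]
    (hact : ∀ Z m, Continuous (typeAct (U.obj Z) m))
    (hmor : ∀ {Z W : A} (f : Z ⟶ W), Continuous (U.map f).hom)
    (init : ∀ (S : Action (Type u) M) (Φ : ∀ Z : A, (S ⟶ U.obj Z) → Prop), InitialLift U Φ)
    (hinit : ∀ (S : Action (Type u) M) (Φ : ∀ Z : A, (S ⟶ U.obj Z) → Prop) {ι : Type u}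
      (l : Filter ι) (k : ι → S.V) (s : S.V),
      (∀ Z g, Φ Z g → Tendsto (fun i => g.hom (k i)) l (𝓝 (g.hom s))) →
      Tendsto (fun i => (init S Φ).iso.inv.hom (k i)) l (𝓝 ((init S Φ).iso.inv.hom s)))
    (P : ObjectProperty A)
    (hP : ∀ Z, P Z ↔ CompactSpace (U.obj Z).V ∧ T2Space (U.obj Z).V) : HasReflections P := by
  refine hasReflections_of_ultrafilter U hact hmor init hinit P (fun Z hZ => ((hP Z).1 hZ).2) ?_
  intro X Q q Φ h1 h2 h3 h4 h5 h6 _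
  have hall : ∀ u, u ∈ convergentUltrafilters U P X := by
    intro u Z hZ f
    have := ((hP Z).1 hZ).1
    exact ⟨_, (u.map (U.map f).hom).le_nhds_lim⟩
  choose L hL using fun u => h5 u (hall u)
  have hLsurj : Function.Surjective L := by
    intro s
    obtain ⟨u, -, hu⟩ := h6 s
    refine ⟨u, h2 _ _ fun Z g hg => ?_⟩
    have := ((hP Z).1 (h1 Z g hg)).2
    exact tendsto_nhds_unique (hL u Z g hg) (hu Z g hg)
  refine (hP _).2 ⟨?_, t2Space_initialLift U hmor _ (fun Z g hg => ((hP Z).1 (h1 Z g hg)).2) h2⟩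
  -- Composing `L` with a member of `Φ` gives the canonical extension to the space of ultrafilters,
  -- which is continuous. Hence the lift is a continuous image of this compact space.
  have hcont : Continuous fun u => (init Q Φ).iso.inv.hom (L u) := by
    refine continuous_iff_continuousAt.2 fun u => hinit Q Φ (𝓝 u) L (L u) fun Z g hg => ?_
    obtain ⟨_, _⟩ := (hP Z).1 (h1 Z g hg)
    have hext : (fun v => g.hom (L v)) = Ultrafilter.extend (q ≫ g).hom := by
      funext v
      exact (ultrafilter_extend_eq_iff.2 (hL v Z g hg)).symm
    rw [hext, show g.hom (L u) = Ultrafilter.extend (q ≫ g).hom u from congrFun hext u]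
    exact (continuous_ultrafilter_extend _).tendsto u
  have hsurj : Function.Surjective fun u => (init Q Φ).iso.inv.hom (L u) := by
    intro y
    obtain ⟨u, hu⟩ := hLsurj ((init Q Φ).iso.hom.hom y)
    refine ⟨u, ?_⟩
    dsimp only
    rw [hu]
    exact ConcreteCategory.congr_hom (congrArg Action.Hom.hom (init Q Φ).iso.hom_inv_id) y
  exact hsurj.compactSpace hcont

end Ultrafilters

/-! ### Flows on topological spaces -/

section Top

variable {M : Type u} [Monoid M]

/-- The underlying flow on a set of a flow on a topological space. -/
abbrev topUnderlying (P₀ : ObjectProperty TopCat.{u}) (F : ObjectProperty (Action TopCat.{u} M)) :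
    Flow P₀ F ⥤ Action (Type u) M :=
  (flowProp P₀ F).ι ⋙ (forget TopCat.{u}).mapAction M

/-- The flow obtained from a flow on a set by a topology making the action continuous. -/
def topFlow (S : Action (Type u) M) (t : TopologicalSpace S.V)
    (ht : ∀ m, Continuous (typeAct S m)) : Action TopCat.{u} M where
  V := TopCat.of S.V
  ρ :=
    { toFun m := End.of (TopCat.ofHom ⟨typeAct S m, ht m⟩)
      map_one' := by
        change TopCat.ofHom _ = 𝟙 _
        ext x
        exact typeAct_one S x
      map_mul' m n := by
        change TopCat.ofHom _ = TopCat.ofHom _ ≫ TopCat.ofHom _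
        ext x
        exact typeAct_mul S m n x }

variable {P₀ : ObjectProperty TopCat.{u}} {F : ObjectProperty (Action TopCat.{u} M)}

theorem continuous_topAct (X : Action TopCat.{u} M) (m : M) : Continuous (topAct X m) :=
  (TopCat.Hom.hom (End.asHom (X.ρ m))).continuous

theorem hom_topAct {X Y : Action TopCat.{u} M} (f : X ⟶ Y) (m : M) (x : X.V) :
    f.hom (topAct X m x) = topAct Y m (f.hom x) :=
  ConcreteCategory.congr_hom (f.comm m) x

/-- A continuous equivariant map, as a morphism of flows. -/
def topFlowHom {X Y : Flow P₀ F} (f : X.obj.V → Y.obj.V) (hf : Continuous f)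
    (hact : ∀ m x, f (topAct X.obj m x) = topAct Y.obj m (f x)) : X ⟶ Y :=
  ObjectProperty.homMk
    { hom := TopCat.ofHom ⟨f, hf⟩
      comm m := by ext x; exact hact m x }

/-- The map underlying an equivariant map from a flow on a set to a flow on a space. -/
def topMap {S : Action (Type u) M} {Z : Flow P₀ F} (g : S ⟶ (topUnderlying P₀ F).obj Z) :
    S.V → Z.obj.V :=
  fun x => g.hom x

theorem topMap_typeAct {S : Action (Type u) M} {Z : Flow P₀ F}
    (g : S ⟶ (topUnderlying P₀ F).obj Z) (m : M) (x : S.V) :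
    topMap g (typeAct S m x) = topAct Z.obj m (topMap g x) :=
  hom_typeAct g m x

/-- Initial lifts of flows on sets to flows on topological spaces. -/
def topInitialLift {S : Action (Type u) M}
    {Φ : ∀ Z : Flow P₀ F, (S ⟶ (topUnderlying P₀ F).obj Z) → Prop} (t : TopologicalSpace S.V)
    (ht : ∀ m, Continuous (typeAct S m)) (hPF : flowProp P₀ F (topFlow S t ht))
    (hlift : ∀ (Z : Flow P₀ F) (g : S ⟶ (topUnderlying P₀ F).obj Z), Φ Z g →
      Continuous (topMap g))
    (hfac : ∀ (W : Flow P₀ F) (k : W.obj.V → S.V),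
      (∀ (Z : Flow P₀ F) (g : S ⟶ (topUnderlying P₀ F).obj Z), Φ Z g →
        Continuous fun x => topMap g (k x)) → Continuous k) :
    InitialLift (topUnderlying P₀ F) Φ where
  obj := ⟨topFlow S t ht, hPF⟩
  iso := Action.mkIso (Iso.refl _) fun m => rfl
  lift Z g hg := ⟨topFlowHom (topMap g) (hlift Z g hg) fun m x => topMap_typeAct g m x,
    rfl⟩
  factor W k hk := by
    refine ⟨topFlowHom (X := W) (Y := ⟨topFlow S t ht, hPF⟩) (fun x => k.hom x)
      (hfac W _ fun Z g hg => ?_) fun m x => hom_typeAct k m x, rfl⟩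
    obtain ⟨l, hl⟩ := hk Z g hg
    exact (TopCat.Hom.hom l.hom.hom).continuous.congr fun x =>
      ConcreteCategory.congr_hom (congrArg Action.Hom.hom hl) x

/-- The initial topology for a family of maps to flows. -/
@[reducible]
def initialTop {S : Action (Type u) M}
    (Φ : ∀ Z : Flow P₀ F, (S ⟶ (topUnderlying P₀ F).obj Z) → Prop) : TopologicalSpace S.V :=
  ⨅ (Z : Flow P₀ F) (g : S ⟶ (topUnderlying P₀ F).obj Z) (_ : Φ Z g),
    TopologicalSpace.induced (topMap g) inferInstance

section

variable {S : Action (Type u) M} (Φ : ∀ Z : Flow P₀ F, (S ⟶ (topUnderlying P₀ F).obj Z) → Prop)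

theorem continuous_initialTop_rng {X : Type*} [TopologicalSpace X] {k : X → S.V} :
    Continuous[_, initialTop Φ] k ↔
      ∀ (Z : Flow P₀ F) (g : S ⟶ (topUnderlying P₀ F).obj Z), Φ Z g →
        Continuous fun x => topMap g (k x) := by
  simp only [continuous_iInf_rng, continuous_induced_rng]
  exact Iff.rfl

theorem continuous_initialTop_dom (Z : Flow P₀ F) (g : S ⟶ (topUnderlying P₀ F).obj Z)
    (hg : Φ Z g) : Continuous[initialTop Φ, _] (topMap g) :=
  (@continuous_initialTop_rng _ _ _ _ _ Φ _ (initialTop Φ) id).1 (@continuous_id _ (initialTop Φ)) Z g hg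

theorem tendsto_initialTop {ι : Type*} (l : Filter ι) (k : ι → S.V) (s : S.V)
    (h : ∀ (Z : Flow P₀ F) (g : S ⟶ (topUnderlying P₀ F).obj Z), Φ Z g →
      Filter.Tendsto (fun i => topMap g (k i)) l (𝓝 (topMap g s))) :
    Filter.Tendsto k l (@nhds _ (initialTop Φ) s) := by
  simp only [nhds_iInf, Filter.tendsto_iInf, nhds_induced, Filter.tendsto_comap_iff]
  exact h

theorem continuous_typeAct_initialTop (m : M) :
    Continuous[initialTop Φ, initialTop Φ] (typeAct S m) := by
  refine (@continuous_initialTop_rng _ _ _ _ _ Φ _ (initialTop Φ) _).2 fun Z g hg => ?_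
  simp only [topMap_typeAct]
  exact @Continuous.comp _ _ _ (initialTop Φ) _ _ _ _ (continuous_topAct Z.obj m)
    (continuous_initialTop_dom Φ Z g hg)

end

/-- Both conditions concern maps into the flow, hence are tested after composing with each `topMap
g`; by equivariance the composite is given by the action on `Z`. -/
theorem topConstraint_initialTop (𝒮 𝒥 : Set (Set M)) [TopologicalSpace M]
    {S : Action (Type u) M}
    (Φ : ∀ Z : Flow P₀ (topConstraint 𝒮 𝒥), (S ⟶ (topUnderlying P₀ _).obj Z) → Prop) :
    topConstraint 𝒮 𝒥 (topFlow S (initialTop Φ) (continuous_typeAct_initialTop Φ)) := by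
  constructor
  · intro s hs x
    refine (continuous_initialTop_rng Φ).2 fun Z g hg => ?_
    refine (Z.property.2.1 s hs (topMap g x)).congr fun m => ?_
    exact (topMap_typeAct g m.1 x).symm
  · intro s hs
    let _ : TopologicalSpace S.V := initialTop Φ
    refine (continuous_initialTop_rng Φ (X := s × S.V)
      (k := fun p => typeAct S p.1 p.2)).2 fun Z g hg => ?_
    refine ((Z.property.2.2 s hs).comp (continuous_id.prodMap
      (continuous_initialTop_dom Φ Z g hg))).congr fun p => ?_
    exact (topMap_typeAct g p.1.1 p.2).symm

/-- Initial lifts for flows on topological spaces. -/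
def topInit [TopologicalSpace M] (𝒮 𝒥 : Set (Set M)) (S : Action (Type u) M)
    (Φ : ∀ Z : Flow TopClass.all.prop (topConstraint 𝒮 𝒥),
      (S ⟶ (topUnderlying TopClass.all.prop _).obj Z) → Prop) :
    InitialLift (topUnderlying TopClass.all.prop (topConstraint 𝒮 𝒥)) Φ :=
  topInitialLift (initialTop Φ) (continuous_typeAct_initialTop Φ)
    ⟨trivial, topConstraint_initialTop 𝒮 𝒥 Φ⟩ (fun Z g hg => continuous_initialTop_dom Φ Z g hg)
    fun _ _ h => (continuous_initialTop_rng Φ).2 h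

theorem hasReflections_topClass [TopologicalSpace M] (𝒮 𝒥 : Set (Set M)) (𝒞 : TopClass) :
    HasReflections (carrierProp (P₀ := TopClass.all.prop) 𝒞.prop (topConstraint 𝒮 𝒥)) := by
  by_cases hc : 𝒞 = .compactT2
  · subst hc
    let _ (Z : Flow TopClass.all.prop (topConstraint 𝒮 𝒥)) : TopologicalSpace
        ((topUnderlying TopClass.all.prop (topConstraint 𝒮 𝒥)).obj Z).V :=
      Z.obj.V.str
    exact hasReflections_compactT2 (topUnderlying TopClass.all.prop (topConstraint 𝒮 𝒥))
      (fun Z m => continuous_topAct Z.obj m) (fun f => (TopCat.Hom.hom f.hom.hom).continuous)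
      (topInit 𝒮 𝒥) (fun S Φ _ l k s h => tendsto_initialTop Φ l k s h) _ fun Z => Iff.rfl
  -- All remaining classes are closed under initial topologies of point-separating families.
  refine hasReflections_of_separatesPoints _ _ (topInit 𝒮 𝒥) fun S Φ hΦ hsep => ?_
  have hsep' : ∀ x y : S.V, x ≠ y → ∃ Z g, Φ Z g ∧ topMap g x ≠ topMap g y := by
    intro x y hxy
    by_contra! hcon
    exact hxy (hsep x y hcon)
  let t := initialTop Φ
  change 𝒞.prop (TopCat.of S.V)
  cases 𝒞 with
  | all => trivial
  | T0 =>
    refine ⟨fun x y hxy => ?_⟩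
    by_contra hne
    obtain ⟨Z, g, hg, hgne⟩ := hsep' x y hne
    have : T0Space Z.obj.V := hΦ Z g hg
    exact hgne (hxy.map (continuous_initialTop_dom Φ Z g hg)).eq
  | T1 =>
    refine t1Space_iff_specializes_imp_eq.2 fun x y hxy => ?_
    by_contra hne
    obtain ⟨Z, g, hg, hgne⟩ := hsep' x y hne
    have : T1Space Z.obj.V := hΦ Z g hg
    exact hgne (hxy.map (continuous_initialTop_dom Φ Z g hg)).eq
  | T2 =>
    refine ⟨fun x y hne => ?_⟩
    obtain ⟨Z, g, hg, hgne⟩ := hsep' x y hne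
    have : T2Space Z.obj.V := hΦ Z g hg
    exact separated_by_continuous (continuous_initialTop_dom Φ Z g hg) hgne
  | T2f =>
    intro x y hne
    obtain ⟨Z, g, hg, hgne⟩ := hsep' x y hne
    obtain ⟨f, hf, hne⟩ := (hΦ Z g hg : FunctionallyHausdorff Z.obj.V) _ _ hgne
    exact ⟨_, hf.comp (continuous_initialTop_dom Φ Z g hg), hne⟩
  | Tychonoff =>
    have h0 : T0Space S.V := by
      refine ⟨fun x y hxy => ?_⟩
      by_contra hne
      obtain ⟨Z, g, hg, hgne⟩ := hsep' x y hne
      have : T35Space Z.obj.V := hΦ Z g hg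
      exact hgne (hxy.map (continuous_initialTop_dom Φ Z g hg)).eq
    have h1 : CompletelyRegularSpace S.V := by
      refine completelyRegularSpace_iInf fun Z => completelyRegularSpace_iInf fun g => ?_
      rw [← iInf_plift_down]
      refine completelyRegularSpace_iInf fun ⟨hg⟩ => ?_
      have : T35Space Z.obj.V := hΦ Z g hg
      exact completelyRegularSpace_induced inferInstance _
    exact { }
  | compactT2 => exact absurd rfl hc

instance hasColimits_topFlow [TopologicalSpace M] (𝒮 𝒥 : Set (Set M)) :
    HasColimits (Flow (TopClass.all.prop : ObjectProperty TopCat.{u}) (topConstraint 𝒮 𝒥)) :=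
  ⟨fun J _ => hasColimitsOfShape_of_initialLift (topUnderlying _ _)
    (fun S Φ => ⟨topInit 𝒮 𝒥 S Φ⟩) J⟩

/-- The diagonal of a square between a surjection and an embedding is defined by choosing preimages;
its continuity and equivariance are checked after applying the embedding. -/
theorem hasReflections_embedsInReflection_top (Q : ObjectProperty TopCat.{u})
    (himage : ∀ {X Y : Flow Q F} (f : X ⟶ Y), ∃ (I : Flow Q F) (p : X ⟶ I) (j : I ⟶ Y), p ≫ j = f ∧
        Function.Surjective p.hom.hom ∧ IsEmbedding j.hom.hom) {P : ObjectProperty TopCat.{u}}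
    (h : P ≤ Q)
    (hR : ∀ X : Flow Q F,
      ∃ (Y : Flow P F) (r : X ⟶ (flowIncl h F).obj Y), IsReflection (flowIncl h F) r) :
    HasReflections (embedsInReflection topEmbedding h F) := by
  refine hasReflections_of_factorization (flowIncl h F) (fun _ _ f => topEmbedding f.hom.hom) _
    (fun X => Iff.rfl) hR fun X Y r => ?_
  obtain ⟨I, p, j, hpj, hp, hj⟩ := himage r
  refine ⟨I, p, j, hpj, hj, ⟨fun a b hab => ?_⟩, fun W V e f g he hpg => ?_⟩
  · ext x
    obtain ⟨x, rfl⟩ := hp x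
    exact ConcreteCategory.congr_hom (congrArg (fun k => k.hom.hom) hab) x
  · have he : IsEmbedding e.hom.hom := he
    have hpg' : ∀ x, g.hom.hom (p.hom.hom x) = e.hom.hom (f.hom.hom x) := fun x =>
      ConcreteCategory.congr_hom (congrArg (fun k => k.hom.hom) hpg) x
    choose d hd using hp
    have hed : ∀ y, e.hom.hom (f.hom.hom (d y)) = g.hom.hom y := fun y => by rw [← hpg', hd]
    refine ⟨topFlowHom (fun y => f.hom.hom (d y)) (he.isInducing.continuous_iff.2 ?_) ?_, ?_⟩
    · exact (TopCat.Hom.hom g.hom.hom).continuous.congr fun y => (hed y).symm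
    · intro m y
      refine he.injective ?_
      rw [hed, hom_topAct, hom_topAct, hed]
    · ext x
      refine he.injective ?_
      exact (hed _).trans (hpg' x)

theorem topAct_one (X : Action TopCat.{u} M) (x : X.V) : topAct X 1 x = x :=
  typeAct_one (((forget TopCat.{u}).mapAction M).obj X) x

theorem topAct_mul (X : Action TopCat.{u} M) (m n : M) (x : X.V) :
    topAct X (m * n) x = topAct X m (topAct X n x) :=
  typeAct_mul (((forget TopCat.{u}).mapAction M).obj X) m n x

theorem exists_image_topConstraint [TopologicalSpace M] (𝒮 𝒥 : Set (Set M))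
    (Q : ObjectProperty TopCat.{u})
    (hQ : ∀ {X Y : TopCat.{u}} (f : X ⟶ Y), Q X → Q Y → Q (TopCat.of (Set.range f)))
    {X Y : Flow Q (topConstraint 𝒮 𝒥)} (f : X ⟶ Y) :
    ∃ (I : Flow Q (topConstraint 𝒮 𝒥)) (p : X ⟶ I) (j : I ⟶ Y), p ≫ j = f ∧
      Function.Surjective p.hom.hom ∧ IsEmbedding j.hom.hom := by
  have hmem : ∀ (m : M) (y : Set.range f.hom.hom), topAct Y.obj m y ∈ Set.range f.hom.hom := by
    rintro m ⟨_, x, rfl⟩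
    exact ⟨topAct X.obj m x, hom_topAct _ _ _⟩
  let S : Action (Type u) M := actionOfMaps (Set.range f.hom.hom)
    (fun m y => ⟨topAct Y.obj m y, hmem m y⟩)
    (fun y => Subtype.ext (topAct_one _ _)) (fun m n y => Subtype.ext (topAct_mul _ _ _ _))
  let I : Flow Q (topConstraint 𝒮 𝒥) :=
    ⟨topFlow S (instTopologicalSpaceSubtype (p := (· ∈ Set.range f.hom.hom)))
      fun m => ((continuous_topAct Y.obj m).comp continuous_subtype_val).subtype_mk _,
      hQ f.hom.hom X.property.1 Y.property.1,
      fun s hs x => (Y.property.2.1 s hs x.1).subtype_mk _,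
      fun s hs => ((Y.property.2.2 s hs).comp
        (continuous_id.prodMap continuous_subtype_val)).subtype_mk _⟩
  refine ⟨I, topFlowHom (Y := I) (fun x => (⟨f.hom.hom x, x, rfl⟩ : Set.range f.hom.hom))
    ((TopCat.Hom.hom f.hom.hom).continuous.subtype_mk _)
    (fun m x => Subtype.ext (hom_topAct _ _ _)),
    topFlowHom (X := I) (fun y : Set.range f.hom.hom => y.1) continuous_subtype_val
      fun m x => rfl, rfl, ?_, IsEmbedding.subtypeVal⟩
  rintro ⟨_, x, rfl⟩
  exact ⟨x, rfl⟩

theorem topClass_prop_range (𝒟 : TopClass) {X Y : TopCat.{u}} (f : X ⟶ Y) (hX : 𝒟.prop X)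
    (hY : 𝒟.prop Y) : 𝒟.prop (TopCat.of (Set.range f)) := by
  cases 𝒟 with
  | all => trivial
  | T0 =>
    have : T0Space Y := hY
    exact inferInstanceAs (T0Space (Set.range f))
  | T1 =>
    have : T1Space Y := hY
    exact inferInstanceAs (T1Space (Set.range f))
  | T2 =>
    have : T2Space Y := hY
    exact inferInstanceAs (T2Space (Set.range f))
  | T2f =>
    intro x y hxy
    obtain ⟨g, hg, hne⟩ := (hY : FunctionallyHausdorff Y) x.1 y.1 fun h => hxy (Subtype.ext h)
    exact ⟨fun z => g z.1, hg.comp continuous_subtype_val, hne⟩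
  | Tychonoff =>
    have : T35Space Y := hY
    exact inferInstanceAs (T35Space (Set.range f))
  | compactT2 =>
    obtain ⟨_, _⟩ := hX
    obtain ⟨_, _⟩ := hY
    exact ⟨isCompact_iff_compactSpace.1 (isCompact_range (TopCat.Hom.hom f).continuous),
      inferInstanceAs (T2Space (Set.range f))⟩

theorem reflective_and_cocomplete_top [TopologicalSpace M] (𝒮 𝒥 : Set (Set M)) (𝒞 𝒟 : TopClass)
    (h : 𝒞.prop ≤ (𝒟.prop : ObjectProperty TopCat.{u})) :
    Nonempty (Reflective (flowIncl h (topConstraint 𝒮 𝒥))) ∧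
      HasColimits (Flow 𝒟.prop (topConstraint 𝒮 𝒥)) ∧
      Nonempty (Reflective (embedsInReflection topEmbedding h (topConstraint 𝒮 𝒥)).ι) ∧
      HasColimits (embedsInReflection topEmbedding h (topConstraint 𝒮 𝒥)).FullSubcategory :=
  reflective_and_cocomplete (P₀ := TopClass.all.prop) h (fun _ _ => trivial) _ _
    (hasReflections_topClass 𝒮 𝒥 𝒞) (hasReflections_topClass 𝒮 𝒥 𝒟)
    (hasReflections_embedsInReflection_top 𝒟.prop
      (exists_image_topConstraint 𝒮 𝒥 𝒟.prop (topClass_prop_range 𝒟)) h)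

end Top

/-! ### Flows on compactly generated spaces -/

section KTop

/-- The compactly generated topology associated with a topology, on the same type. -/
@[reducible]
noncomputable def kTopology {X : Type*} (t : TopologicalSpace X) : TopologicalSpace X :=
  TopologicalSpace.coinduced (CompactCoherentification.mk X).symm
    CompactCoherentification.instTopologicalSpace

/-- The identification of the two models of the associated compactly generated space. -/
noncomputable def kHomeo {X : Type*} (t : TopologicalSpace X) :
    @Homeomorph (CompactCoherentification X) X _ (kTopology t) :=
  @Homeomorph.mk _ _ _ (kTopology t) (CompactCoherentification.mk X).symm
    (continuous_coinduced_rng)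
    (continuous_coinduced_dom.2 (by
      have : ((CompactCoherentification.mk X).symm.symm ∘ (CompactCoherentification.mk X).symm) =
        id := by ext; simp
      exact this ▸ continuous_id))

theorem kTopology_le {X : Type*} (t : TopologicalSpace X) : kTopology t ≤ t :=
  continuous_iff_coinduced_le.1 CompactCoherentification.continuous_mk_symm

theorem compactlyCoherentSpace_of_homeomorph {X Y : Type*} [TopologicalSpace X]
    [TopologicalSpace Y] [CompactlyCoherentSpace X] (e : X ≃ₜ Y) : CompactlyCoherentSpace Y := by
  refine .of_isOpen fun A hA => ?_
  rw [← e.isOpen_preimage, CompactlyCoherentSpace.isOpen_iff]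
  intro K hK
  have : Continuous fun x : K => (⟨e x, x, x.2, rfl⟩ : e '' K) :=
    (e.continuous.comp continuous_subtype_val).subtype_mk _
  exact (hA (e '' K) (hK.image e.continuous)).preimage this

theorem compactlyCoherentSpace_kTopology {X : Type*} (t : TopologicalSpace X) :
    @CompactlyCoherentSpace X (kTopology t) :=
  @compactlyCoherentSpace_of_homeomorph _ _ _ (kTopology t) _ (kHomeo t)

/-- This is the universal property of the coreflection, which lets the initial topology be replaced
by its compactly generated refinement. -/
theorem continuous_kTopology_rng {X Y : Type*} [TopologicalSpace X] [CompactlyCoherentSpace X]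
    {t : TopologicalSpace Y} {f : X → Y} (hf : Continuous f) :
    Continuous[_, kTopology t] f := by
  have h1 : Continuous (CompactCoherentification.map f ∘ CompactCoherentification.mk X) :=
    (CompactCoherentification.continuous_map_of_continuous hf).comp
      CompactCoherentification.continuous_mk
  have h2 : Continuous[_, kTopology t] (CompactCoherentification.mk Y).symm :=
    continuous_coinduced_rng
  convert @Continuous.comp _ _ _ _ _ (kTopology t) _ _ h2 h1 using 1
  ext x
  simp [CompactCoherentification.map]

variable {M : Type u} [Monoid M] [TopologicalSpace M]

section

variable (𝒮 𝒥 : Set (Set M)) {S : Action (Type u) M}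
  (Φ : ∀ Z : Flow KTopClass.all.prop (kTopConstraint 𝒮 𝒥),
    (S ⟶ (topUnderlying KTopClass.all.prop _).obj Z) → Prop)

theorem continuous_typeAct_kTopology (m : M) :
    Continuous[kTopology (initialTop Φ), kTopology (initialTop Φ)] (typeAct S m) :=
  @continuous_kTopology_rng _ _ (kTopology (initialTop Φ)) (compactlyCoherentSpace_kTopology _) _ _
    (continuous_le_dom (kTopology_le _) (continuous_typeAct_initialTop Φ m))

theorem continuous_initialTop_dom_kTopology (Z : Flow KTopClass.all.prop (kTopConstraint 𝒮 𝒥))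
    (g : S ⟶ (topUnderlying KTopClass.all.prop (kTopConstraint 𝒮 𝒥)).obj Z) (hg : Φ Z g) :
    Continuous[kTopology (initialTop Φ), _] (topMap g) :=
  continuous_le_dom (kTopology_le _) (continuous_initialTop_dom Φ Z g hg)

/-- The sources `κ(S)` and the `κ`-product are compactly generated, so continuity into the refined
topology amounts to continuity into the initial one. -/
theorem kTopConstraint_kTopology :
    kTopConstraint 𝒮 𝒥
      (topFlow S (kTopology (initialTop Φ)) (continuous_typeAct_kTopology 𝒮 𝒥 Φ)) := by
  constructor
  · intro s hs x
    refine continuous_kTopology_rng ((continuous_initialTop_rng Φ).2 fun Z g hg => ?_)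
    refine (Z.property.2.1 s hs (topMap g x)).congr fun m => ?_
    exact (topMap_typeAct g _ x).symm
  · intro s hs
    let _ : TopologicalSpace S.V := kTopology (initialTop Φ)
    refine continuous_kTopology_rng (X := KProd (CompactCoherentification s) S.V)
      ((continuous_initialTop_rng Φ).2 fun Z g hg => ?_)
    have hmap := CompactCoherentification.continuous_map_of_continuous
      ((continuous_id (X := CompactCoherentification s)).prodMap
        (continuous_initialTop_dom_kTopology 𝒮 𝒥 Φ Z g hg))
    refine ((Z.property.2.2 s hs).comp hmap).congr fun p => ?_
    simp only [Function.comp_apply, CompactCoherentification.map, Equiv.symm_apply_apply,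
      Prod.map_fst, Prod.map_snd, id_eq]
    exact (topMap_typeAct g _ _).symm

/-- Initial lifts for flows on compactly generated spaces. -/
noncomputable def kTopInit : InitialLift (topUnderlying KTopClass.all.prop (kTopConstraint 𝒮 𝒥)) Φ :=
  topInitialLift (kTopology (initialTop Φ)) (continuous_typeAct_kTopology 𝒮 𝒥 Φ)
    ⟨compactlyCoherentSpace_kTopology _, kTopConstraint_kTopology 𝒮 𝒥 Φ⟩
    (fun Z g hg => continuous_initialTop_dom_kTopology 𝒮 𝒥 Φ Z g hg)
    fun W _ h =>
      have : CompactlyCoherentSpace W.obj.V := W.property.1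
      continuous_kTopology_rng ((continuous_initialTop_rng Φ).2 h)

end

theorem hasReflections_kTopClass (𝒮 𝒥 : Set (Set M)) (𝒞 : KTopClass) :
    HasReflections (carrierProp (P₀ := KTopClass.all.prop) 𝒞.prop (kTopConstraint 𝒮 𝒥)) := by
  refine hasReflections_of_separatesPoints _ _ (fun S Φ => kTopInit 𝒮 𝒥 Φ) fun S Φ hΦ hsep => ?_
  cases 𝒞 with
  | all => exact compactlyCoherentSpace_kTopology _
  | T2 =>
    let _ (Z : Flow KTopClass.all.prop (kTopConstraint 𝒮 𝒥)) : TopologicalSpace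
        ((topUnderlying KTopClass.all.prop (kTopConstraint 𝒮 𝒥)).obj Z).V := Z.obj.V.str
    exact ⟨compactlyCoherentSpace_kTopology _,
      t2Space_initialLift (topUnderlying KTopClass.all.prop (kTopConstraint 𝒮 𝒥)) (fun f => (TopCat.Hom.hom f.hom.hom).continuous) (kTopInit 𝒮 𝒥 Φ)
        (fun Z g hg => (hΦ Z g hg).2) hsep⟩

instance hasColimits_kTopFlow (𝒮 𝒥 : Set (Set M)) :
    HasColimits (Flow (KTopClass.all.prop : ObjectProperty TopCat.{u}) (kTopConstraint 𝒮 𝒥)) :=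
  ⟨fun J _ => hasColimitsOfShape_of_initialLift (topUnderlying _ _)
    (fun _ Φ => ⟨kTopInit 𝒮 𝒥 Φ⟩) J⟩

theorem KTopClass.prop_le_all (𝒟 : KTopClass) :
    𝒟.prop ≤ (KTopClass.all.prop : ObjectProperty TopCat.{u}) := by
  intro X hX
  cases 𝒟 with
  | all => exact hX
  | T2 => exact hX.1

/-- Subspaces of compactly generated spaces need not be compactly generated, so images are avoided:
a space embedded in a Hausdorff one is Hausdorff, hence the embedding flows are already in `𝒞`. -/
theorem reflective_and_cocomplete_kTop (𝒮 𝒥 : Set (Set M)) (𝒞 𝒟 : KTopClass)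
    (h : 𝒞.prop ≤ (𝒟.prop : ObjectProperty TopCat.{u})) :
    Nonempty (Reflective (flowIncl h (kTopConstraint 𝒮 𝒥))) ∧
      HasColimits (Flow 𝒟.prop (kTopConstraint 𝒮 𝒥)) ∧
      Nonempty (Reflective (embedsInReflection topEmbedding h (kTopConstraint 𝒮 𝒥)).ι) ∧
      HasColimits (embedsInReflection topEmbedding h (kTopConstraint 𝒮 𝒥)).FullSubcategory := by
  refine reflective_and_cocomplete (P₀ := KTopClass.all.prop) h 𝒟.prop_le_all _ _
    (hasReflections_kTopClass 𝒮 𝒥 𝒞) (hasReflections_kTopClass 𝒮 𝒥 𝒟) fun hR =>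
    hasReflections_embedsInReflection_of_eq h _ _ (fun X => IsEmbedding.id) hR
      fun X Y f hX hY hf => ?_
  have hX' := 𝒟.prop_le_all _ hX
  cases 𝒞 with
  | all => exact hX'
  | T2 =>
    have hf : IsEmbedding f := hf
    have := hY.2
    exact ⟨hX', hf.t2Space⟩

end KTop

/-! ### Flows on uniform spaces -/

section Unif

variable {M : Type u} [Monoid M]

/-- The underlying flow on a set of a flow on a uniform space. -/
abbrev unifUnderlying (F : ObjectProperty (Action UniformSpaceCat.{u} M)) :
    Flow UnifClass.all.prop F ⥤ Action (Type u) M :=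
  (flowProp UnifClass.all.prop F).ι ⋙ (forget UniformSpaceCat.{u}).mapAction M

/-- The flow obtained from a flow on a set by a uniformity making the action uniformly
continuous. -/
def unifFlow (S : Action (Type u) M) (t : UniformSpace S.V)
    (ht : ∀ m, UniformContinuous (typeAct S m)) : Action UniformSpaceCat.{u} M where
  V := UniformSpaceCat.of S.V
  ρ :=
    { toFun m := End.of (UniformSpaceCat.ofHom ⟨typeAct S m, ht m⟩)
      map_one' := by
        change UniformSpaceCat.ofHom _ = 𝟙 _
        ext x
        exact typeAct_one S x
      map_mul' m n := by
        change UniformSpaceCat.ofHom _ = UniformSpaceCat.ofHom _ ≫ UniformSpaceCat.ofHom _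
        ext x
        exact typeAct_mul S m n x }

theorem uniformContinuous_hom {X Y : UniformSpaceCat.{u}} (f : X ⟶ Y) : UniformContinuous f :=
  f.hom.property

theorem uniformContinuous_unifAct (X : Action UniformSpaceCat.{u} M) (m : M) :
    UniformContinuous (unifAct X m) :=
  uniformContinuous_hom (End.asHom (X.ρ m))

theorem hom_unifAct {X Y : Action UniformSpaceCat.{u} M} (f : X ⟶ Y) (m : M) (x : X.V) :
    f.hom (unifAct X m x) = unifAct Y m (f.hom x) :=
  ConcreteCategory.congr_hom (f.comm m) x

theorem unifAct_one (X : Action UniformSpaceCat.{u} M) (x : X.V) : unifAct X 1 x = x :=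
  typeAct_one (((forget UniformSpaceCat.{u}).mapAction M).obj X) x

theorem unifAct_mul (X : Action UniformSpaceCat.{u} M) (m n : M) (x : X.V) :
    unifAct X (m * n) x = unifAct X m (unifAct X n x) :=
  typeAct_mul (((forget UniformSpaceCat.{u}).mapAction M).obj X) m n x

variable {F : ObjectProperty (Action UniformSpaceCat.{u} M)}

/-- A uniformly continuous equivariant map, as a morphism of flows. -/
def unifFlowHom {P : ObjectProperty UniformSpaceCat.{u}} {X Y : Flow P F}
    (f : X.obj.V → Y.obj.V) (hf : UniformContinuous f)
    (hact : ∀ m x, f (unifAct X.obj m x) = unifAct Y.obj m (f x)) : X ⟶ Y :=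
  ObjectProperty.homMk
    { hom := UniformSpaceCat.ofHom ⟨f, hf⟩
      comm m := by ext x; exact hact m x }

/-- The map underlying an equivariant map from a flow on a set to a flow on a uniform space. -/
def unifMap {S : Action (Type u) M} {Z : Flow UnifClass.all.prop F}
    (g : S ⟶ (unifUnderlying F).obj Z) : S.V → Z.obj.V :=
  fun x => g.hom x

theorem unifMap_typeAct {S : Action (Type u) M} {Z : Flow UnifClass.all.prop F}
    (g : S ⟶ (unifUnderlying F).obj Z) (m : M) (x : S.V) :
    unifMap g (typeAct S m x) = unifAct Z.obj m (unifMap g x) :=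
  hom_typeAct g m x

/-- The initial uniformity for a family of maps to flows. -/
@[reducible]
def initialUnif {S : Action (Type u) M}
    (Φ : ∀ Z : Flow UnifClass.all.prop F, (S ⟶ (unifUnderlying F).obj Z) → Prop) :
    UniformSpace S.V :=
  ⨅ (Z : Flow UnifClass.all.prop F) (g : S ⟶ (unifUnderlying F).obj Z) (_ : Φ Z g),
    UniformSpace.comap (unifMap g) inferInstance

section

variable {S : Action (Type u) M}
  (Φ : ∀ Z : Flow UnifClass.all.prop F, (S ⟶ (unifUnderlying F).obj Z) → Prop)

theorem tendsto_uniformity_initialUnif {ι : Type*} {l : Filter ι} {k : ι → S.V × S.V} :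
    Filter.Tendsto k l (@uniformity _ (initialUnif Φ)) ↔
      ∀ (Z : Flow UnifClass.all.prop F) (g : S ⟶ (unifUnderlying F).obj Z), Φ Z g →
        Filter.Tendsto (fun i => (unifMap g (k i).1, unifMap g (k i).2)) l (𝓤 Z.obj.V) := by
  simp only [iInf_uniformity, Filter.tendsto_iInf, uniformity_comap, Filter.tendsto_comap_iff]
  exact Iff.rfl

theorem uniformContinuous_initialUnif_rng {X : Type*} [UniformSpace X] {k : X → S.V} :
    UniformContinuous[_, initialUnif Φ] k ↔
      ∀ (Z : Flow UnifClass.all.prop F) (g : S ⟶ (unifUnderlying F).obj Z), Φ Z g →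
        UniformContinuous fun x => unifMap g (k x) :=
  tendsto_uniformity_initialUnif Φ

theorem uniformContinuous_initialUnif_dom (Z : Flow UnifClass.all.prop F)
    (g : S ⟶ (unifUnderlying F).obj Z) (hg : Φ Z g) :
    UniformContinuous[initialUnif Φ, _] (unifMap g) :=
  (@uniformContinuous_initialUnif_rng _ _ _ _ Φ _ (initialUnif Φ) id).1
    (@uniformContinuous_id _ (initialUnif Φ)) Z g hg

theorem tendsto_nhds_initialUnif {ι : Type*} (l : Filter ι) (k : ι → S.V) (s : S.V)
    (h : ∀ (Z : Flow UnifClass.all.prop F) (g : S ⟶ (unifUnderlying F).obj Z), Φ Z g →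
      Filter.Tendsto (fun i => unifMap g (k i)) l (𝓝 (unifMap g s))) :
    Filter.Tendsto k l (@nhds _ (initialUnif Φ).toTopologicalSpace s) := by
  let _ := initialUnif Φ
  rw [Uniform.tendsto_nhds_right]
  exact (tendsto_uniformity_initialUnif Φ).2 fun Z g hg =>
    Uniform.tendsto_nhds_right.1 (h Z g hg)

theorem uniformContinuous_typeAct_initialUnif (m : M) :
    UniformContinuous[initialUnif Φ, initialUnif Φ] (typeAct S m) := by
  refine (@uniformContinuous_initialUnif_rng _ _ _ _ Φ _ (initialUnif Φ) _).2 fun Z g hg => ?_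
  simp only [unifMap_typeAct]
  exact @UniformContinuous.comp _ _ _ (initialUnif Φ) _ _ _ _ (uniformContinuous_unifAct Z.obj m)
    (uniformContinuous_initialUnif_dom Φ Z g hg)

end

/-- A constraint that is inherited by initial uniformities. -/
def InheritedByInitial (F : ObjectProperty (Action UniformSpaceCat.{u} M)) : Prop :=
  ∀ (S : Action (Type u) M)
    (Φ : ∀ Z : Flow UnifClass.all.prop F, (S ⟶ (unifUnderlying F).obj Z) → Prop),
    F (unifFlow S (initialUnif Φ) (uniformContinuous_typeAct_initialUnif Φ))

theorem inheritedByInitial_unifConstraint [UniformSpace M] (𝒮 𝒥 : Set (Set M)) :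
    InheritedByInitial (unifConstraint 𝒮 𝒥) := by
  refine fun S Φ => ⟨fun s hs x => ?_, fun s hs => ?_⟩
  · refine (uniformContinuous_initialUnif_rng Φ).2 fun Z g hg => ?_
    exact (Z.property.2.1 s hs (unifMap g x)).congr fun m =>
      Prod.ext (unifMap_typeAct g m.1.1 x).symm (unifMap_typeAct g m.2.1 x).symm
  · let _ : UniformSpace S.V := initialUnif Φ
    refine (uniformContinuous_initialUnif_rng Φ (X := s × S.V)
      (k := fun p => typeAct S p.1 p.2)).2 fun Z g hg => ?_
    exact ((Z.property.2.2 s hs).comp (uniformContinuous_id.prodMap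
      (uniformContinuous_initialUnif_dom Φ Z g hg))).congr fun p =>
        Prod.ext (unifMap_typeAct g p.1.1.1 p.1.2).symm (unifMap_typeAct g p.2.1.1 p.2.2).symm

/-- Written as convergence to the uniformity, boundedness can be tested on the family defining an
initial uniformity; the factor `⊤` encodes uniformity in `x`. -/
theorem bounded_iff_tendsto {G : Type u} [Group G] [TopologicalSpace G]
    (X : Action UniformSpaceCat.{u} G) : bounded X ↔
      Filter.Tendsto (fun p : G × X.V => (unifAct X p.1 p.2, p.2)) (𝓝 1 ×ˢ ⊤) (𝓤 X.V) := by
  refine forall₂_congr fun V _ => ?_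
  rw [Filter.mem_map, Filter.mem_prod_top, ← Filter.exists_mem_subset_iff]
  exact exists_congr fun N => and_congr_right fun _ => ⟨fun h s hs x => h s hs x,
    fun h s hs x => h hs x⟩

theorem quasiBounded_iff_tendsto {G : Type u} [Group G] [TopologicalSpace G]
    (X : Action UniformSpaceCat.{u} G) : quasiBounded X ↔
      Filter.Tendsto (fun p : G × X.V × X.V => (unifAct X p.1 p.2.1, unifAct X p.1 p.2.2))
        (𝓝 1 ×ˢ 𝓤 X.V) (𝓤 X.V) := by
  refine forall₂_congr fun W _ => ?_
  rw [Filter.mem_map, Filter.mem_prod_iff]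
  refine exists_congr fun N => and_congr_right fun _ => exists_congr fun V =>
    and_congr_right fun _ => ⟨fun h p hp => h p.1 hp.1 _ _ hp.2, fun h s hs x y hxy =>
      h (Set.mk_mem_prod hs hxy)⟩

theorem inheritedByInitial_bounded {G : Type u} [Group G] [TopologicalSpace G] :
    InheritedByInitial (bounded (G := G)) := by
  intro S Φ
  rw [bounded_iff_tendsto]
  refine (tendsto_uniformity_initialUnif Φ).2 fun Z g hg => ?_
  refine (((bounded_iff_tendsto _).1 Z.property.2).comp
    (Filter.tendsto_id.prodMap (Filter.tendsto_top (f := unifMap g)))).congr fun p => ?_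
  exact Prod.ext (unifMap_typeAct g p.1 p.2).symm rfl

theorem inheritedByInitial_quasiBounded {G : Type u} [Group G] [TopologicalSpace G] :
    InheritedByInitial (quasiBounded (G := G)) := by
  intro S Φ
  rw [quasiBounded_iff_tendsto]
  refine (tendsto_uniformity_initialUnif Φ).2 fun Z g hg => ?_
  refine (((quasiBounded_iff_tendsto _).1 Z.property.2).comp
    (Filter.tendsto_id.prodMap (uniformContinuous_initialUnif_dom Φ Z g hg))).congr fun p => ?_
  exact Prod.ext (unifMap_typeAct g p.1 p.2.1).symm (unifMap_typeAct g p.1 p.2.2).symm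

/-- Initial lifts for flows on uniform spaces. -/
def unifInit (hF : InheritedByInitial F) (S : Action (Type u) M)
    (Φ : ∀ Z : Flow UnifClass.all.prop F, (S ⟶ (unifUnderlying F).obj Z) → Prop) :
    InitialLift (unifUnderlying F) Φ where
  obj := ⟨unifFlow S (initialUnif Φ) (uniformContinuous_typeAct_initialUnif Φ), trivial, hF S Φ⟩
  iso := Action.mkIso (Iso.refl _) fun m => rfl
  lift Z g hg := ⟨unifFlowHom (unifMap g) (uniformContinuous_initialUnif_dom Φ Z g hg)
    fun m x => unifMap_typeAct g m x, rfl⟩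
  factor W k hk := by
    refine ⟨unifFlowHom (X := W)
      (Y := ⟨unifFlow S (initialUnif Φ) (uniformContinuous_typeAct_initialUnif Φ), trivial,
        hF S Φ⟩) (fun x => k.hom x)
      ((uniformContinuous_initialUnif_rng Φ).2 fun Z g hg => ?_) fun m x => hom_typeAct k m x, rfl⟩
    obtain ⟨l, hl⟩ := hk Z g hg
    have hl' : ∀ x, l.hom.hom x = unifMap g (k.hom x) := fun x =>
      ConcreteCategory.congr_hom (congrArg Action.Hom.hom hl) x
    exact (uniformContinuous_hom l.hom.hom).congr fun p => Prod.ext (hl' p.1) (hl' p.2)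

theorem hasColimits_unifFlow (hF : InheritedByInitial F) :
    HasColimits (Flow (UnifClass.all.prop : ObjectProperty UniformSpaceCat.{u}) F) :=
  ⟨fun J _ => hasColimitsOfShape_of_initialLift (unifUnderlying F)
    (fun S Φ => ⟨unifInit hF S Φ⟩) J⟩

theorem hasReflections_unifClass (hF : InheritedByInitial F) (𝒞 : UnifClass) :
    HasReflections (carrierProp (P₀ := UnifClass.all.prop) 𝒞.prop F) := by
  let τ (Z : Flow UnifClass.all.prop F) : TopologicalSpace ((unifUnderlying F).obj Z).V :=
    Z.obj.V.str.toTopologicalSpace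
  have hmor : ∀ {Z W : Flow UnifClass.all.prop F} (f : Z ⟶ W),
      Continuous ((unifUnderlying F).map f).hom := fun f => (uniformContinuous_hom f.hom.hom).continuous
  cases 𝒞 with
  | all => exact hasReflections_of_separatesPoints _ _ (unifInit hF) fun S Φ hΦ hsep => trivial
  | T2 =>
    exact hasReflections_of_separatesPoints _ _ (unifInit hF) fun S Φ hΦ hsep =>
      t2Space_initialLift (unifUnderlying F) hmor (unifInit hF S Φ) hΦ hsep
  | compactT2 =>
    exact hasReflections_compactT2 (unifUnderlying F)
      (fun Z m => (uniformContinuous_unifAct Z.obj m).continuous) hmor (unifInit hF)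
      (fun S Φ _ l k s h => tendsto_nhds_initialUnif Φ l k s h) _ fun Z => Iff.rfl
  | completeT2 =>
    refine hasReflections_of_ultrafilter (unifUnderlying F)
      (fun Z m => (uniformContinuous_unifAct Z.obj m).continuous) hmor (unifInit hF)
      (fun S Φ _ l k s h => tendsto_nhds_initialUnif Φ l k s h) _ (fun Z hZ => hZ.2) ?_
    intro X Q q Φ h1 h2 h3 h4 h5 h6 hdense
    refine ⟨?_, t2Space_initialLift (unifUnderlying F) hmor (unifInit hF Q Φ)
      (fun Z g hg => (h1 Z g hg).2) h2⟩
    let _ : UniformSpace Q.V := initialUnif Φ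
    let m : X.obj.V → Q.V := fun x => q.hom x
    -- The uniformity pulled back from `Q` replaces the original one on `X`, so that `m` is a dense
    -- uniform inducing map and completeness need only be tested on Cauchy filters of `X`.
    let _ : UniformSpace X.obj.V := UniformSpace.comap m inferInstance
    have hm : IsUniformInducing m := ⟨rfl⟩
    refine completeSpace_extension hm hdense fun f hf => ?_
    have := hf.1
    let v := Ultrafilter.of f
    have hv : (v : Filter X.obj.V) ≤ f := Ultrafilter.of_le f
    have hvc : Cauchy (v : Filter X.obj.V) := hf.mono hv
    -- An ultrafilter finer than the Cauchy filter `f` has Cauchy, hence convergent, images in every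
    -- complete target; its limit is then a cluster point of the image of `f`.
    have hmem : v ∈ convergentUltrafilters (unifUnderlying F)
        (carrierProp UnifClass.completeT2.prop F) X := by
      intro Z hZ φ
      obtain ⟨g, hg, hqg⟩ := h4 Z hZ φ
      have : CompleteSpace Z.obj.V := hZ.1
      obtain ⟨z, hz⟩ := CompleteSpace.complete (hvc.map
        ((uniformContinuous_initialUnif_dom Φ Z g hg).comp hm.uniformContinuous))
      refine ⟨z, ?_⟩
      rw [← hqg]
      exact hz
    obtain ⟨s, hs⟩ := h5 v hmem
    refine ⟨s, le_nhds_of_cauchy_adhp (hf.map hm.uniformContinuous) ?_⟩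
    have hvs : Filter.Tendsto m v (𝓝 s) := tendsto_nhds_initialUnif Φ _ _ _ hs
    exact (ClusterPt.of_le_nhds hvs).mono (Filter.map_mono hv)

/-- For a general inherited constraint, the image must carry an initial uniformity. The family of
all morphisms out of `Y` restricted to the range gives exactly the subspace uniformity, which is
what `hΦ` records. -/
theorem exists_image_unif (hF : InheritedByInitial F) (Q : ObjectProperty UniformSpaceCat.{u})
    (hQ : ∀ {X Y : UniformSpaceCat.{u}} (f : X ⟶ Y), Q X → Q Y →
      Q (UniformSpaceCat.of (Set.range f)))
    {X Y : Flow Q F} (f : X ⟶ Y) :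
    ∃ (I : Flow Q F) (p : X ⟶ I) (j : I ⟶ Y), p ≫ j = f ∧
      Function.Surjective p.hom.hom ∧ IsUniformEmbedding j.hom.hom := by
  have hmem : ∀ (m : M) (y : Set.range f.hom.hom), unifAct Y.obj m y ∈ Set.range f.hom.hom := by
    rintro m ⟨_, x, rfl⟩
    exact ⟨unifAct X.obj m x, hom_unifAct _ _ _⟩
  let S : Action (Type u) M := actionOfMaps (Set.range f.hom.hom)
    (fun m y => ⟨unifAct Y.obj m y, hmem m y⟩)
    (fun y => Subtype.ext (unifAct_one _ _)) (fun m n y => Subtype.ext (unifAct_mul _ _ _ _))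
  let Y' : Flow UnifClass.all.prop F := ⟨Y.obj, trivial, Y.property.2⟩
  let i : S ⟶ (unifUnderlying F).obj Y' :=
    homOfMap (fun y : Set.range f.hom.hom => y.1) fun m y => rfl
  let Φ : ∀ Z : Flow UnifClass.all.prop F, (S ⟶ (unifUnderlying F).obj Z) → Prop :=
    fun Z g => ∃ l : Y' ⟶ Z, g = i ≫ (unifUnderlying F).map l
  have hΦ : initialUnif Φ = instUniformSpaceSubtype (p := (· ∈ Set.range f.hom.hom)) := by
    refine le_antisymm ?_ (le_iInf fun Z => le_iInf fun g => le_iInf fun hg => ?_)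
    · exact iInf_le_of_le Y' (iInf_le_of_le i (iInf_le _ ⟨𝟙 _, by simp⟩))
    · obtain ⟨l, rfl⟩ := hg
      exact uniformContinuous_iff_le_comap.1
        ((uniformContinuous_hom l.hom.hom).comp uniformContinuous_subtype_val)
  let I : Flow Q F := ⟨unifFlow S (initialUnif Φ) (uniformContinuous_typeAct_initialUnif Φ),
    by
      change Q (@UniformSpaceCat.of (Set.range f.hom.hom) (initialUnif Φ))
      rw [hΦ]
      exact hQ f.hom.hom X.property.1 Y.property.1, hF S Φ⟩
  have hj : @IsUniformEmbedding (Set.range f.hom.hom) Y.obj.V (initialUnif Φ) _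
      Subtype.val := by
    rw [hΦ]
    exact isUniformEmbedding_subtype_val
  refine ⟨I, unifFlowHom (Y := I) (fun x => (⟨f.hom.hom x, x, rfl⟩ : Set.range f.hom.hom)) ?_
    (fun m x => Subtype.ext (hom_unifAct _ _ _)),
    unifFlowHom (X := I) (fun y : Set.range f.hom.hom => y.1)
      (@IsUniformInducing.uniformContinuous _ _ (initialUnif Φ) _ _
        (@IsUniformEmbedding.isUniformInducing _ _ (initialUnif Φ) _ _ hj)) fun m x => rfl, rfl, ?_, hj⟩
  · change @UniformContinuous _ _ _ (initialUnif Φ) _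
    rw [hΦ]
    exact (uniformContinuous_hom f.hom.hom).subtype_mk _
  · rintro ⟨_, x, rfl⟩
    exact ⟨x, rfl⟩

theorem hasReflections_embedsInReflection_unif (Q : ObjectProperty UniformSpaceCat.{u})
    (himage : ∀ {X Y : Flow Q F} (f : X ⟶ Y), ∃ (I : Flow Q F) (p : X ⟶ I) (j : I ⟶ Y),
      p ≫ j = f ∧ Function.Surjective p.hom.hom ∧ IsUniformEmbedding j.hom.hom)
    {P : ObjectProperty UniformSpaceCat.{u}} (h : P ≤ Q)
    (hR : ∀ X : Flow Q F,
      ∃ (Y : Flow P F) (r : X ⟶ (flowIncl h F).obj Y), IsReflection (flowIncl h F) r) :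
    HasReflections (embedsInReflection unifEmbedding h F) := by
  refine hasReflections_of_factorization (flowIncl h F) (fun _ _ f => unifEmbedding f.hom.hom) _
    (fun X => Iff.rfl) hR fun X Y r => ?_
  obtain ⟨I, p, j, hpj, hp, hj⟩ := himage r
  refine ⟨I, p, j, hpj, hj, ⟨fun a b hab => ?_⟩, fun W V e f g he hpg => ?_⟩
  · ext x
    obtain ⟨x, rfl⟩ := hp x
    exact ConcreteCategory.congr_hom (congrArg (fun k => k.hom.hom) hab) x
  · have he : IsUniformEmbedding e.hom.hom := he
    have hpg' : ∀ x, g.hom.hom (p.hom.hom x) = e.hom.hom (f.hom.hom x) := fun x =>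
      ConcreteCategory.congr_hom (congrArg (fun k => k.hom.hom) hpg) x
    choose d hd using hp
    have hed : ∀ y, e.hom.hom (f.hom.hom (d y)) = g.hom.hom y := fun y => by rw [← hpg', hd]
    refine ⟨unifFlowHom (fun y => f.hom.hom (d y))
      (he.isUniformInducing.uniformContinuous_iff.2 ?_) ?_, ?_⟩
    · exact (uniformContinuous_hom g.hom.hom).congr fun y =>
        Prod.ext (hed y.1).symm (hed y.2).symm
    · intro m y
      refine he.injective ?_
      rw [hed, hom_unifAct, hom_unifAct, hed]
    · ext x
      refine he.injective ?_
      exact (hed _).trans (hpg' x)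

theorem unifClass_prop_range (𝒟 : UnifClass) (h𝒟 : 𝒟 ≠ .completeT2) {X Y : UniformSpaceCat.{u}}
    (f : X ⟶ Y) (hX : 𝒟.prop X) (hY : 𝒟.prop Y) :
    𝒟.prop (UniformSpaceCat.of (Set.range f)) := by
  cases 𝒟 with
  | all => trivial
  | T2 =>
    have : T2Space Y := hY
    exact inferInstanceAs (T2Space (Set.range f))
  | completeT2 => exact absurd rfl h𝒟
  | compactT2 =>
    obtain ⟨_, _⟩ := hX
    obtain ⟨_, _⟩ := hY
    exact ⟨isCompact_iff_compactSpace.1 (isCompact_range (uniformContinuous_hom f).continuous),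
      inferInstanceAs (T2Space (Set.range f))⟩

/-- The essential case is the compact one: a complete subspace of a Hausdorff space is closed, hence
compact when the ambient space is. -/
theorem unifClass_prop_of_isUniformEmbedding (𝒞 : UnifClass) {X Y : UniformSpaceCat.{u}}
    (f : X ⟶ Y) (hX : UnifClass.completeT2.prop X) (hY : 𝒞.prop Y) (hf : IsUniformEmbedding f) :
    𝒞.prop X := by
  obtain ⟨hc, h2⟩ := hX
  cases 𝒞 with
  | all => trivial
  | T2 => exact h2
  | completeT2 => exact ⟨hc, h2⟩
  | compactT2 =>
    obtain ⟨_, _⟩ := hY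
    have hcl : IsClosed (Set.range f) :=
      ((completeSpace_iff_isComplete_range hf.isUniformInducing).1 hc).isClosed
    exact ⟨(IsClosedEmbedding.mk hf.isEmbedding hcl).compactSpace, h2⟩

theorem reflective_and_cocomplete_unif (hF : InheritedByInitial F) (𝒞 𝒟 : UnifClass)
    (h : 𝒞.prop ≤ (𝒟.prop : ObjectProperty UniformSpaceCat.{u})) :
    Nonempty (Reflective (flowIncl h F)) ∧ HasColimits (Flow 𝒟.prop F) ∧
      Nonempty (Reflective (embedsInReflection unifEmbedding h F).ι) ∧
      HasColimits (embedsInReflection unifEmbedding h F).FullSubcategory := by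
  have := hasColimits_unifFlow hF
  refine reflective_and_cocomplete (P₀ := UnifClass.all.prop) h (fun _ _ => trivial) _ _
    (hasReflections_unifClass hF 𝒞) (hasReflections_unifClass hF 𝒟) fun hR => ?_
  by_cases h𝒟 : 𝒟 = .completeT2
  · subst h𝒟
    exact hasReflections_embedsInReflection_of_eq h _ _ (fun X => ⟨IsUniformInducing.id, Function.injective_id⟩) hR
      fun X Y f hX hY hf => unifClass_prop_of_isUniformEmbedding 𝒞 f hX hY hf
  · exact hasReflections_embedsInReflection_unif 𝒟.prop
      (exists_image_unif hF 𝒟.prop (unifClass_prop_range 𝒟 h𝒟)) h hR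

end Unif

end EquivariantFlows

/-- In each case below, for an inclusion of `𝒞` in `𝒟`: the flows in `𝒞` are reflective among the
flows in `𝒟`, which form a cocomplete category; and the full subcategory on those flows in `𝒟`
whose reflection among the flows in `𝒞` is an isomorphism onto its image is reflective and
cocomplete. -/
theorem corollary2p10 :
    (∀ (M : Type u) [Monoid M] [TopologicalSpace M] [ContinuousMul M] (𝒮 𝒥 : Set (Set M))
        (𝒞 𝒟 : EquivariantFlows.TopClass)
        (h : 𝒞.prop ≤ (𝒟.prop : ObjectProperty TopCat.{u}))
        (F : ObjectProperty (Action TopCat.{u} M)),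
        F = EquivariantFlows.topConstraint 𝒮 𝒥 →
      Nonempty (Reflective (EquivariantFlows.flowIncl h F)) ∧
      HasColimits (EquivariantFlows.Flow 𝒟.prop F) ∧
      Nonempty (Reflective
        (EquivariantFlows.embedsInReflection EquivariantFlows.topEmbedding h F).ι) ∧
      HasColimits
        (EquivariantFlows.embedsInReflection EquivariantFlows.topEmbedding h F).FullSubcategory) ∧
    (∀ (M : Type u) [Monoid M] [UniformSpace M] (𝒮 𝒥 : Set (Set M))
        (𝒞 𝒟 : EquivariantFlows.UnifClass)
        (h : 𝒞.prop ≤ (𝒟.prop : ObjectProperty UniformSpaceCat.{u}))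
        (F : ObjectProperty (Action UniformSpaceCat.{u} M)),
        F = EquivariantFlows.unifConstraint 𝒮 𝒥 →
      Nonempty (Reflective (EquivariantFlows.flowIncl h F)) ∧
      HasColimits (EquivariantFlows.Flow 𝒟.prop F) ∧
      Nonempty (Reflective
        (EquivariantFlows.embedsInReflection EquivariantFlows.unifEmbedding h F).ι) ∧
      HasColimits
        (EquivariantFlows.embedsInReflection EquivariantFlows.unifEmbedding h F).FullSubcategory) ∧
    (∀ (M : Type u) [Monoid M] [TopologicalSpace M] (_ : EquivariantFlows.IsKMonoid M)
        (𝒮 𝒥 : Set (Set M)) (𝒞 𝒟 : EquivariantFlows.KTopClass)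
        (h : 𝒞.prop ≤ (𝒟.prop : ObjectProperty TopCat.{u}))
        (F : ObjectProperty (Action TopCat.{u} M)),
        F = EquivariantFlows.kTopConstraint 𝒮 𝒥 →
      Nonempty (Reflective (EquivariantFlows.flowIncl h F)) ∧
      HasColimits (EquivariantFlows.Flow 𝒟.prop F) ∧
      Nonempty (Reflective
        (EquivariantFlows.embedsInReflection EquivariantFlows.topEmbedding h F).ι) ∧
      HasColimits
        (EquivariantFlows.embedsInReflection EquivariantFlows.topEmbedding h F).FullSubcategory) ∧
    (∀ (G : Type u) [Group G] [TopologicalSpace G] [IsTopologicalGroup G]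
        (𝒞 𝒟 : EquivariantFlows.UnifClass)
        (h : 𝒞.prop ≤ (𝒟.prop : ObjectProperty UniformSpaceCat.{u}))
        (F : ObjectProperty (Action UniformSpaceCat.{u} G)),
        (F = EquivariantFlows.bounded ∨ F = EquivariantFlows.quasiBounded) →
      Nonempty (Reflective (EquivariantFlows.flowIncl h F)) ∧
      HasColimits (EquivariantFlows.Flow 𝒟.prop F) ∧
      Nonempty (Reflective
        (EquivariantFlows.embedsInReflection EquivariantFlows.unifEmbedding h F).ι) ∧
      HasColimits
        (EquivariantFlows.embedsInReflection EquivariantFlows.unifEmbedding h F).FullSubcategory) := by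
  refine ⟨?_, ?_, ?_, ?_⟩
  · rintro M _ _ _ 𝒮 𝒥 𝒞 𝒟 h F rfl
    exact EquivariantFlows.reflective_and_cocomplete_top 𝒮 𝒥 𝒞 𝒟 h
  · rintro M _ _ 𝒮 𝒥 𝒞 𝒟 h F rfl
    exact EquivariantFlows.reflective_and_cocomplete_unif
      (EquivariantFlows.inheritedByInitial_unifConstraint 𝒮 𝒥) 𝒞 𝒟 h
  · rintro M _ _ _ 𝒮 𝒥 𝒞 𝒟 h F rfl
    exact EquivariantFlows.reflective_and_cocomplete_kTop 𝒮 𝒥 𝒞 𝒟 h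
  · rintro G _ _ _ 𝒞 𝒟 h F (rfl | rfl)
    · exact EquivariantFlows.reflective_and_cocomplete_unif
        EquivariantFlows.inheritedByInitial_bounded 𝒞 𝒟 h
    · exact EquivariantFlows.reflective_and_cocomplete_unif
        EquivariantFlows.inheritedByInitial_quasiBounded 𝒞 𝒟 h
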